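/- Let $(X_t,Y_t)_{t\ge1}$ be a pair of real random sequences on a probability space, let $Q_t\ge 0$ $(t\ge1)$ be real numbers, let $\mathcal Y_t=\sigma(Y_s,\,1\le s\le t)$, and let $h_t$ be $\mathcal Y_t$-measurable real random variables $(t\ge 1)$. Let $(\bar\varepsilon_t)_{t\ge1}$ be i.i.d. $\mathcal N(0,1)$ variables, independent of the process $(X,Y)$, and put $$Y^2_t=Q_t(X_t-h_t)+\sqrt{Q_t}\,\bar\varepsilon_t,\qquad \xi_t=\sum_{s=1}^t (X_s-h_s)Y^2_s$$ (the $2$ in $Y^2_t$ is an index). Let $\bar{\mathcal Y}_{t}=\sigma(Y_s,Y^2_s,\ 1\le s\le t)$ and $\bar{\mathcal Y}_{t,t-1}=\sigma(Y_s,Y^2_r,\ 1\le s\le t,\ 1\le r\le t-1)$; $\pi_t$ and $\bar\pi_t$ denote conditional expectation given $\mathcal Y_t$ and $\bar{\mathcal Y}_t$. Conditional expectations are meant in the generalized sense $\mathbb E(\eta/\mathcal G)=\mathbb E(\eta^+/\mathcal G)-\mathbb E(\eta^- /\mathcal G)$, defined whenever $\mathbb E(|\eta|/\mathcal G)<\infty$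 a.s. Define $$\mathcal I_T=\mathbb E\Big(\exp\Big\{-\tfrac12\sum_{s=1}^T (X_s-h_s)^2Q_s\Big\}\Big/\mathcal Y_T\Big),\qquad \widetilde\gamma_t=\mathbb E\big(X_t-\mathbb E(X_t/\bar{\mathcal Y}_{t,t-1})\big)^2,$$ $$\widetilde Z^h_t=\mathbb E(X_t/\bar{\mathcal Y}_{t,t-1})-\mathbb E\big[(X_t-\mathbb E(X_t/\bar{\mathcal Y}_{t,t-1}))(\xi_{t-1}-\bar\pi_{t-1}(\xi_{t-1}))\big/\bar{\mathcal Y}_{t,t-1}\big],$$ $$\sigma_t^2=\mathbb E(Y_t-\pi_{t-1}(Y_t))^2,\quad \bar\sigma_t^2=\mathbb E(Y_t-\bar\pi_{t-1}(Y_t))^2,\quad \bar V_t=\bar\pi_{t-1}(Y_t)-\bar\gamma_{Y\xi}(t),$$ $$\bar\gamma_{Y\xi}(t)=\mathbb E\big[(Y_t-\bar\pi_{t-1}(Y_t))(\xi_{t-1}-\bar\pi_{t-1}(\xi_{t-1}))\big/\bar{\mathcal Y}_{t-1}\big].$$ (a) Suppose that $(X_t,Y_t)_{t\ge1}$ is a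 Gaussian process and $\sigma_t^2>0$ for all $t\ge1$. Then all the quantities above are well defined and the variances $\sigma_t^2,\bar\sigma_t^2,\widetilde\gamma_t$ are finite, $\bar\sigma_t^2>0$ for all $t\ge 1$, and for every $T\ge1$, almost surely, $$\mathcal I_T=\prod_{t=1}^T\big[1+Q_t\widetilde\gamma_t\big]^{-1/2}\exp\Big\{-\frac12\,\frac{Q_t}{1+Q_t\widetilde\gamma_t}\big[h_t-\widetilde Z^h_t\big]^2\Big\}\times\mathcal M_T,$$ where $$\mathcal M_T=\prod_{t=1}^T\Big[\frac{\sigma_t^2}{\bar\sigma_t^2}\Big]^{1/2}\exp\Big\{\frac1{2\sigma_t^2}(Y_t-\pi_{t-1}(Y_t))^2-\frac1{2\bar\sigma_t^2}(Y_t-\bar V_t)^2\Big\}$$ is (up to modification on null sets) a martingale with respect to $(\mathcal Y_T)$. (b) The same holds when $(X_t,Y_t)_{t\ge1}$ is only conditionally Gaussian, that is, when for every $t\ge1$ the conditional law of $(X_1,\dots,X_t,Y_t)$ given $(Y_1,\dots,Y_{t-1})$ is almost surely Gaussian, provided that $\sigma_t^2$, $\bar\sigma_t^2$, $\widetilde\gamma_t$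 are replaced by the conditional variances $\mathbb E[(Y_t-\pi_{t-1}(Y_t))^2/\mathcal Y_{t-1}]$, $\mathbb E[(Y_t-\bar\pi_{t-1}(Y_t))^2/\bar{\mathcal Y}_{t-1}]$, $\mathbb E[(X_t-\mathbb E(X_t/\bar{\mathcal Y}_{t,t-1}))^2/\bar{\mathcal Y}_{t,t-1}]$ and that the first of these is almost surely positive for every $t\ge 1$. -/

import Mathlib

open MeasureTheory ProbabilityTheory

namespace LEGFilter

variable {Ω : Type*}

/-- The generalized conditional expectation `E[f⁺ | m] - E[f⁻ | m]` of a real random variable. It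
makes sense as soon as `E[|f| | m] < ∞` almost surely, and is the usual conditional expectation when
`f` is integrable. It is needed because `ξ` below need not be integrable when `h` is arbitrary. -/
noncomputable def condMean (m : MeasurableSpace Ω) {mΩ : MeasurableSpace Ω} (P : Measure Ω)
    (f : Ω → ℝ) : Ω → ℝ := fun ω =>
  (condLExp m P (fun ω' => ENNReal.ofReal (f ω')) ω).toReal
    - (condLExp m P (fun ω' => ENNReal.ofReal (-f ω')) ω).toReal

/-- `E[|f| | m] < ∞` almost surely: `condMean m P f` is meaningful. -/
def CondIntegrable (m : MeasurableSpace Ω) {mΩ : MeasurableSpace Ω} (P : Measure Ω)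
    (f : Ω → ℝ) : Prop :=
  ∀ᵐ ω ∂P, condLExp m P (fun ω' => ENNReal.ofReal |f ω'|) ω < ⊤

/-- For integrable variables `condMean` is the conditional expectation. -/
theorem condMean_ae_eq_condExp (m : MeasurableSpace Ω) {mΩ : MeasurableSpace Ω} (P : Measure Ω)
    {f : Ω → ℝ} (hf : Integrable f P) : condMean m P f =ᵐ[P] P[f | m] := by
  have h1 := toReal_condLExp m (μ := P) (f := fun ω => ENNReal.ofReal (f ω))
    hf.aemeasurable.ennreal_ofReal hf.lintegral_lt_top.ne
  have h2 := toReal_condLExp m (μ := P) (f := fun ω => ENNReal.ofReal (-f ω))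
    hf.neg.aemeasurable.ennreal_ofReal hf.neg.lintegral_lt_top.ne
  have e : f = (fun ω => (ENNReal.ofReal (f ω)).toReal)
      - (fun ω => (ENNReal.ofReal (-f ω)).toReal) := by
    funext ω
    simp only [Pi.sub_apply, ENNReal.toReal_ofReal']
    exact (max_zero_sub_max_neg_zero_eq_self (f ω)).symm
  have i1 : Integrable (fun ω => (ENNReal.ofReal (f ω)).toReal) P := by
    simpa only [ENNReal.toReal_ofReal'] using hf.pos_part
  have i2 : Integrable (fun ω => (ENNReal.ofReal (-f ω)).toReal) P := by
    simpa only [ENNReal.toReal_ofReal'] using hf.neg_part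
  have h3 := condExp_sub i1 i2 m
  rw [← e] at h3
  filter_upwards [h1, h2, h3] with ω a b c
  rw [c, Pi.sub_apply, ← a, ← b, condMean]

/-- `σ(U_s, 1 ≤ s ≤ t)`; it is trivial for `t = 0`. -/
def pastSigma (U : ℕ → Ω → ℝ) (t : ℕ) : MeasurableSpace Ω :=
  ⨆ s ∈ Finset.Icc 1 t, MeasurableSpace.comap (U s) inferInstance

/-- The observation filtration `𝒴_t = σ(Y_s, 1 ≤ s ≤ t)`. -/
def obsFiltration {mΩ : MeasurableSpace Ω} (Y : ℕ → Ω → ℝ)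
    (hY : ∀ t, 1 ≤ t → Measurable (Y t)) : Filtration ℕ mΩ where
  seq := pastSigma Y
  mono' _ _ hst := biSup_mono fun _ hs =>
    Finset.mem_Icc.2 ⟨(Finset.mem_Icc.1 hs).1, (Finset.mem_Icc.1 hs).2.trans hst⟩
  le' _ := iSup₂_le fun s hs => (hY s (Finset.mem_Icc.1 hs).1).comap_le

/-- `((X_t, Y_t))_{t ≥ 1}` is a Gaussian process. -/
def GaussianPair {mΩ : MeasurableSpace Ω} (P : Measure Ω) (X Y : ℕ → Ω → ℝ) : Prop :=
  IsGaussianProcess (fun (t : ℕ) ω => (X (t + 1) ω, Y (t + 1) ω)) P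

/-- `((X_t, Y_t))_{t ≥ 1}` is conditionally Gaussian: for every `t ≥ 1` the regular conditional law
of `(X_1, …, X_t, Y_t)` given `(Y_1, …, Y_{t-1})` is almost surely Gaussian. -/
def ConditionallyGaussianPair {mΩ : MeasurableSpace Ω} (P : Measure Ω) [IsFiniteMeasure P]
    (X Y : ℕ → Ω → ℝ) : Prop :=
  ∀ t, 1 ≤ t → ∀ᵐ ω ∂P, IsGaussian
    (condDistrib (fun ω' => ((fun s : Finset.Icc 1 t => X s ω'), Y t ω'))
      (fun ω' => fun s : Finset.Icc 1 (t - 1) => Y s ω') P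
      (fun s : Finset.Icc 1 (t - 1) => Y s ω))

/-- `ε_1, ε_2, …` are i.i.d. standard Gaussian, and independent of `((X_t, Y_t))_{t ≥ 1}`. -/
structure IsAuxiliaryNoise {mΩ : MeasurableSpace Ω} (P : Measure Ω) (X Y ε : ℕ → Ω → ℝ) :
    Prop where
  measurable : ∀ t, 1 ≤ t → Measurable (ε t)
  law : ∀ t, 1 ≤ t → P.map (ε t) = gaussianReal 0 1
  iIndep : iIndepFun (fun (t : ℕ) => ε (t + 1)) P
  indep : IndepFun (fun ω (t : ℕ) => (X (t + 1) ω, Y (t + 1) ω)) (fun ω (t : ℕ) => ε (t + 1) ω) P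

/-- The auxiliary observation `Y²_t = Q_t (X_t - h_t) + √Q_t ε_t` (the `2` is an index). -/
noncomputable def auxObs (X ε h : ℕ → Ω → ℝ) (Q : ℕ → ℝ) (t : ℕ) (ω : Ω) : ℝ :=
  Q t * (X t ω - h t ω) + √(Q t) * ε t ω

/-- `ξ_t = ∑_{s ≤ t} (X_s - h_s) Y²_s`. -/
noncomputable def xi (X ε h : ℕ → Ω → ℝ) (Q : ℕ → ℝ) (t : ℕ) (ω : Ω) : ℝ :=
  ∑ s ∈ Finset.Icc 1 t, (X s ω - h s ω) * auxObs X ε h Q s ω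

/-- `σ(Y_s, Y²_r, 1 ≤ s ≤ t, 1 ≤ r ≤ u)`. -/
noncomputable def auxSigma (X Y ε h : ℕ → Ω → ℝ) (Q : ℕ → ℝ) (t u : ℕ) : MeasurableSpace Ω :=
  pastSigma Y t ⊔ pastSigma (auxObs X ε h Q) u

section

variable {mΩ : MeasurableSpace Ω} (P : Measure Ω) (X Y ε h : ℕ → Ω → ℝ) (Q : ℕ → ℝ)

/-- The prediction error `Y_t - E[Y_t | 𝒴_{t-1}]`. -/
noncomputable def errY (t : ℕ) (ω : Ω) : ℝ :=
  Y t ω - condMean (pastSigma Y (t - 1)) P (Y t) ω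

/-- The prediction error `Y_t - E[Y_t | 𝒴̄_{t-1}]`. -/
noncomputable def errYBar (t : ℕ) (ω : Ω) : ℝ :=
  Y t ω - condMean (auxSigma X Y ε h Q (t - 1) (t - 1)) P (Y t) ω

/-- The filtering error `X_t - E[X_t | 𝒴̄_{t,t-1}]`. -/
noncomputable def errX (t : ℕ) (ω : Ω) : ℝ :=
  X t ω - condMean (auxSigma X Y ε h Q t (t - 1)) P (X t) ω

/-- `ξ_{t-1} - E[ξ_{t-1} | 𝒴̄_{t-1}]`. -/
noncomputable def errXi (t : ℕ) (ω : Ω) : ℝ :=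
  xi X ε h Q (t - 1) ω
    - condMean (auxSigma X Y ε h Q (t - 1) (t - 1)) P (xi X ε h Q (t - 1)) ω

/-- `Z̃ʰ_t = E[X_t | 𝒴̄_{t,t-1}]
  - E[(X_t - E[X_t | 𝒴̄_{t,t-1}]) (ξ_{t-1} - E[ξ_{t-1} | 𝒴̄_{t-1}]) | 𝒴̄_{t,t-1}]`. -/
noncomputable def zTilde (t : ℕ) (ω : Ω) : ℝ :=
  condMean (auxSigma X Y ε h Q t (t - 1)) P (X t) ω
    - condMean (auxSigma X Y ε h Q t (t - 1)) P
        (fun ω' => errX P X Y ε h Q t ω' * errXi P X Y ε h Q t ω') ω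

/-- `γ̄_{Yξ}(t) = E[(Y_t - E[Y_t | 𝒴̄_{t-1}]) (ξ_{t-1} - E[ξ_{t-1} | 𝒴̄_{t-1}]) | 𝒴̄_{t-1}]`. -/
noncomputable def gammaYXi (t : ℕ) (ω : Ω) : ℝ :=
  condMean (auxSigma X Y ε h Q (t - 1) (t - 1)) P
    (fun ω' => errYBar P X Y ε h Q t ω' * errXi P X Y ε h Q t ω') ω

/-- `V̄_t = E[Y_t | 𝒴̄_{t-1}] - γ̄_{Yξ}(t)`. -/
noncomputable def vBar (t : ℕ) (ω : Ω) : ℝ :=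
  condMean (auxSigma X Y ε h Q (t - 1) (t - 1)) P (Y t) ω - gammaYXi P X Y ε h Q t ω

/-- All the conditional expectations and (conditional) variances at time `t` that enter the formula
are meaningful, not just values given by convention. -/
structure MomentsExist (t : ℕ) : Prop where
  predY : CondIntegrable (pastSigma Y (t - 1)) P (Y t)
  predYBar : CondIntegrable (auxSigma X Y ε h Q (t - 1) (t - 1)) P (Y t)
  filterX : CondIntegrable (auxSigma X Y ε h Q t (t - 1)) P (X t)
  predXi : CondIntegrable (auxSigma X Y ε h Q (t - 1) (t - 1)) P (xi X ε h Q (t - 1))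
  covXXi : CondIntegrable (auxSigma X Y ε h Q t (t - 1)) P
    (fun ω => errX P X Y ε h Q t ω * errXi P X Y ε h Q t ω)
  covYXi : CondIntegrable (auxSigma X Y ε h Q (t - 1) (t - 1)) P
    (fun ω => errYBar P X Y ε h Q t ω * errXi P X Y ε h Q t ω)
  varY : CondIntegrable (pastSigma Y (t - 1)) P (fun ω => errY P Y t ω ^ 2)
  varYBar : CondIntegrable (auxSigma X Y ε h Q (t - 1) (t - 1)) P
    (fun ω => errYBar P X Y ε h Q t ω ^ 2)
  varX : CondIntegrable (auxSigma X Y ε h Q t (t - 1)) P (fun ω => errX P X Y ε h Q t ω ^ 2)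

/-- `σ_t² = E (Y_t - E[Y_t | 𝒴_{t-1}])²`. -/
noncomputable def sigmaSq (t : ℕ) : ℝ := ∫ ω, errY P Y t ω ^ 2 ∂P

/-- `σ̄_t² = E (Y_t - E[Y_t | 𝒴̄_{t-1}])²`. -/
noncomputable def sigmaBarSq (t : ℕ) : ℝ := ∫ ω, errYBar P X Y ε h Q t ω ^ 2 ∂P

/-- `γ̃_t = E (X_t - E[X_t | 𝒴̄_{t,t-1}])²`. -/
noncomputable def gammaTilde (t : ℕ) : ℝ := ∫ ω, errX P X Y ε h Q t ω ^ 2 ∂P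

/-- Conditional version of `σ_t²`: `E[(Y_t - E[Y_t | 𝒴_{t-1}])² | 𝒴_{t-1}]`. -/
noncomputable def condSigmaSq (t : ℕ) (ω : Ω) : ℝ :=
  condMean (pastSigma Y (t - 1)) P (fun ω' => errY P Y t ω' ^ 2) ω

/-- Conditional version of `σ̄_t²`: `E[(Y_t - E[Y_t | 𝒴̄_{t-1}])² | 𝒴̄_{t-1}]`. -/
noncomputable def condSigmaBarSq (t : ℕ) (ω : Ω) : ℝ :=
  condMean (auxSigma X Y ε h Q (t - 1) (t - 1)) P (fun ω' => errYBar P X Y ε h Q t ω' ^ 2) ω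

/-- Conditional version of `γ̃_t`: `E[(X_t - E[X_t | 𝒴̄_{t,t-1}])² | 𝒴̄_{t,t-1}]`. -/
noncomputable def condGammaTilde (t : ℕ) (ω : Ω) : ℝ :=
  condMean (auxSigma X Y ε h Q t (t - 1)) P (fun ω' => errX P X Y ε h Q t ω' ^ 2) ω

/-- `ℐ_T = E[exp(-½ ∑_{s ≤ T} (X_s - h_s)² Q_s) | 𝒴_T]`. -/
noncomputable def conditionalLaplace (T : ℕ) : Ω → ℝ :=
  P[fun ω => Real.exp (-(1 / 2) * ∑ s ∈ Finset.Icc 1 T, (X s ω - h s ω) ^ 2 * Q s)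
    | pastSigma Y T]

/-- The factor of index `t` of `ℐ_T` outside the martingale, for a given value `g` of `γ̃_t`. -/
noncomputable def mainFactor (g : ℝ) (t : ℕ) (ω : Ω) : ℝ :=
  (1 + Q t * g) ^ (-(1 / 2) : ℝ)
    * Real.exp (-(1 / 2) * (Q t / (1 + Q t * g)) * (h t ω - zTilde P X Y ε h Q t ω) ^ 2)

/-- The factor of index `t` of the martingale, for given values `v`, `w` of `σ_t²`, `σ̄_t²`. -/
noncomputable def martingaleFactor (v w : ℝ) (t : ℕ) (ω : Ω) : ℝ :=
  (v / w) ^ (1 / 2 : ℝ)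
    * Real.exp (1 / (2 * v) * (Y t ω - condMean (pastSigma Y (t - 1)) P (Y t) ω) ^ 2
        - 1 / (2 * w) * (Y t ω - vBar P X Y ε h Q t ω) ^ 2)

/-- `ℳ_T` for a Gaussian pair. -/
noncomputable def martingaleM (T : ℕ) (ω : Ω) : ℝ :=
  ∏ t ∈ Finset.Icc 1 T,
    martingaleFactor P X Y ε h Q (sigmaSq P Y t) (sigmaBarSq P X Y ε h Q t) t ω

/-- `ℳ_T` for a conditionally Gaussian pair: the variances are conditional. -/
noncomputable def condMartingaleM (T : ℕ) (ω : Ω) : ℝ :=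
  ∏ t ∈ Finset.Icc 1 T,
    martingaleFactor P X Y ε h Q (condSigmaSq P Y t ω) (condSigmaBarSq P X Y ε h Q t ω) t ω

end

/-- `M` is a martingale up to versions. The random variables `M_t` here are built from versions of
conditional expectations that are fixed only almost surely (and are measurable for a larger
σ-algebra), so that `M_t` itself is only almost surely equal to an `ℱ_t`-measurable variable. -/
def IsMartingaleVersion {mΩ : MeasurableSpace Ω} (P : Measure Ω) (ℱ : Filtration ℕ mΩ)
    (M : ℕ → Ω → ℝ) : Prop :=
  ∃ N : ℕ → Ω → ℝ, Martingale N ℱ P ∧ ∀ t, M t =ᵐ[P] N t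

end LEGFilter

/-! Fix `n` and a random vector `V` of which X_1, …, X_{n+1} and Y_{n+1} are linear functionals,
with an almost surely Gaussian conditional law κ given 𝒴_n. Conditionally on the process (X, Y), the
auxiliary observation Y²_s has law 𝒩(Q_s (X_s - h_s), Q_s), whose density with respect to 𝒩(0, Q_s)
is exp(Y²_s (X_s - h_s) - Q_s (X_s - h_s)²/2). By Bayes' formula the law of `V` given 𝒴̄_n is
therefore κ weighted by the product of these exponentials and normalized (`IsCondLaw.bayes`,
`IsCondLaw.sup_pastSigma_auxObs`). Such a weighted law is again Gaussian, with explicit mass, mean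
and covariance (`exists_isGaussian_withDensity_expQuad`), and the covariance involves neither Y² nor
h.

The linear part of the exponent is exactly ξ_n. Removing it is a tilt by exp(-ξ_n), which lowers the
mean of each functional by its covariance with ξ_n. Hence V̄_{n+1} and Z̃ʰ_{n+1} are the means of
Y_{n+1} and X_{n+1} under laws weighted by w_n = exp(-½ ∑_{s ≤ n} (X_s - h_s)² Q_s) alone, from
which the auxiliary observations have disappeared; σ̄² and γ̃ are the corresponding variances
(`nullLaw`, `vBar_eq`, `zTilde_eq`).

This gives a one-step recursion (`laplace_succ`). E(w_n | 𝒴_{n+1}) is E(w_n | 𝒴_n) times the ratio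
of the densities of Y_{n+1} under `nullLaw` and under κ, which is the new factor of ℳ. The remaining
exponential in X_{n+1} is then integrated against a Gaussian law of mean Z̃ʰ and variance γ̃, which
produces the other factor. A ratio of predictive densities has conditional mean one, so ℳ is a
martingale. For a Gaussian pair the conditional covariances do not depend on ω, so the conditional
variances are constants, equal to the unconditional ones. -/

open MeasureTheory ProbabilityTheory

namespace LEGFilter

open scoped ENNReal NNReal

set_option linter.unusedSectionVars false

/-! ### One-dimensional Gaussian laws with exponential-quadratic densities -/

/-- The weight `exp (z (l - h) - q (l - h)² / 2)`. -/
noncomputable def expQuad (q z h l : ℝ) : ℝ≥0∞ :=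
  ENNReal.ofReal (Real.exp (z * (l - h) - q * (l - h) ^ 2 / 2))

/-- The integral of `expQuad q z h` for the Gaussian law of mean `m` and variance `v`. -/
noncomputable def expQuadMass (q z h m v : ℝ) : ℝ :=
  (1 + q * v) ^ (-(1 / 2) : ℝ)
    * Real.exp ((v * z ^ 2 / 2 + z * (m - h) - q * (m - h) ^ 2 / 2) / (1 + q * v))

@[fun_prop]
lemma Measurable.expQuad {α : Type*} {_ : MeasurableSpace α} {q z h l : α → ℝ} (hq : Measurable q)
    (hz : Measurable z) (hh : Measurable h) (hl : Measurable l) :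
    Measurable fun a => expQuad (q a) (z a) (h a) (l a) := by
  unfold LEGFilter.expQuad
  fun_prop

lemma expQuadMass_pos {q v : ℝ} (hq : 0 ≤ q) (hv : 0 ≤ v) (z h m : ℝ) :
    0 < expQuadMass q z h m v := by
  have : 0 < 1 + q * v := by positivity
  unfold expQuadMass
  positivity

/-- A Gaussian law weighted by the exponential of a concave quadratic polynomial is a multiple of a
Gaussian law. -/
lemma gaussianReal_withDensity_expQuad (m : ℝ) (v : ℝ≥0) {q : ℝ} (hq : 0 ≤ q) (z h : ℝ) :
    (gaussianReal m v).withDensity (expQuad q z h)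
      = ENNReal.ofReal (expQuadMass q z h m v)
        • gaussianReal (m + v * (z - q * (m - h)) / (1 + q * v)) (v / (1 + q * v)).toNNReal := by
  have h1 : 0 < 1 + q * v := by positivity
  -- The degenerate law is a Dirac mass, which has no Lebesgue density, and is treated apart.
  by_cases hv : v = 0
  · subst hv
    have hd : (Measure.dirac m).withDensity (expQuad q z h)
        = expQuad q z h m • Measure.dirac m := by
      ext s hs
      have hm : Measurable (expQuad q z h) := by fun_prop
      rw [withDensity_apply _ hs, ← lintegral_indicator hs, lintegral_dirac' _ (hm.indicator hs)]
      by_cases hms : m ∈ s <;> simp [hms, hs]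
    simp only [gaussianReal_zero_var, hd, NNReal.coe_zero]
    simp [expQuad, expQuadMass]
  have hv0 : (0 : ℝ) < v := by positivity
  have hv' : (v / (1 + q * v) : ℝ).toNNReal ≠ 0 := by
    have : 0 < (v / (1 + q * v) : ℝ) := by positivity
    simpa using this
  rw [gaussianReal_of_var_ne_zero _ hv, gaussianReal_of_var_ne_zero _ hv',
    ← withDensity_mul _ (by fun_prop) (by fun_prop), ← withDensity_smul _ (by fun_prop)]
  congr 1
  ext l
  simp only [Pi.mul_apply, Pi.smul_apply, smul_eq_mul, gaussianPDF, expQuad]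
  rw [← ENNReal.ofReal_mul (gaussianPDFReal_nonneg _ _ _),
    ← ENNReal.ofReal_mul (expQuadMass_pos hq hv0.le _ _ _).le]
  congr 1
  simp only [gaussianPDFReal, expQuadMass,
    Real.coe_toNNReal _ (show 0 ≤ (v / (1 + q * v) : ℝ) by positivity)]
  have e1 : (√(2 * Real.pi * v))⁻¹
      = (1 + q * v) ^ (-(1 / 2) : ℝ) * (√(2 * Real.pi * (v / (1 + q * v))))⁻¹ := by
    rw [Real.rpow_neg h1.le, ← Real.sqrt_eq_rpow, ← mul_inv, ← Real.sqrt_mul h1.le]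
    congr 2
    field_simp
  -- Completion of the square in `l`.
  have e2 : Real.exp (-(l - m) ^ 2 / (2 * v)) * Real.exp (z * (l - h) - q * (l - h) ^ 2 / 2)
      = Real.exp ((v * z ^ 2 / 2 + z * (m - h) - q * (m - h) ^ 2 / 2) / (1 + q * v))
        * Real.exp (-(l - (m + v * (z - q * (m - h)) / (1 + q * v))) ^ 2
          / (2 * (v / (1 + q * v)))) := by
    rw [← Real.exp_add, ← Real.exp_add]
    congr 1
    field_simp
    ring
  rw [e1]
  linear_combination
    (1 + q * (v : ℝ)) ^ (-(1 / 2) : ℝ) * (√(2 * Real.pi * (v / (1 + q * v))))⁻¹ * e2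

/-- Two nondegenerate Gaussian laws are equivalent, with the ratio of the densities as density. -/
lemma gaussianReal_withDensity_ratio (m₁ m₂ : ℝ) {v₁ v₂ : ℝ≥0} (h₁ : v₁ ≠ 0) (h₂ : v₂ ≠ 0) :
    (gaussianReal m₁ v₁).withDensity (fun y => ENNReal.ofReal ((v₁ / v₂ : ℝ) ^ (1 / 2 : ℝ)
        * Real.exp (1 / (2 * v₁) * (y - m₁) ^ 2 - 1 / (2 * v₂) * (y - m₂) ^ 2)))
      = gaussianReal m₂ v₂ := by
  have p₁ : (0 : ℝ) < v₁ := by positivity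
  have p₂ : (0 : ℝ) < v₂ := by positivity
  rw [gaussianReal_of_var_ne_zero _ h₁, gaussianReal_of_var_ne_zero _ h₂,
    ← withDensity_mul _ (by fun_prop) (by fun_prop)]
  congr 1
  ext y
  simp only [Pi.mul_apply, gaussianPDF]
  rw [← ENNReal.ofReal_mul (gaussianPDFReal_nonneg _ _ _)]
  congr 1
  simp only [gaussianPDFReal]
  have e1 : (√(2 * Real.pi * v₂))⁻¹ = (√(2 * Real.pi * v₁))⁻¹ * (v₁ / v₂ : ℝ) ^ (1 / 2 : ℝ) := by
    rw [← Real.sqrt_eq_rpow, Real.sqrt_div p₁.le,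
      Real.sqrt_mul (show 0 ≤ 2 * Real.pi by positivity) v₂,
      Real.sqrt_mul (show 0 ≤ 2 * Real.pi by positivity) v₁]
    field_simp
  rw [e1, mul_mul_mul_comm, ← Real.exp_add]
  congr 2
  field_simp
  ring

/-! ### Linear regression of a Gaussian vector on a functional -/

section Regression

variable {E : Type*} [NormedAddCommGroup E] [NormedSpace ℝ E] [CompleteSpace E]
  [MeasurableSpace E] [BorelSpace E] [SecondCountableTopology E]

/-- The regression vector of the identity on the functional `L`, zero if `L` is degenerate. -/
noncomputable def regVec (γ : Measure E) (L : StrongDual ℝ E) : E :=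
  (Var[L; γ])⁻¹ • ∫ v, (L v - γ[L]) • v ∂γ

variable (γ : Measure E)

lemma memLp_dual_two [IsGaussian γ] (L : StrongDual ℝ E) : MemLp L 2 γ :=
  IsGaussian.memLp_dual γ L 2 (by simp)

lemma covarianceBilinDual_eq_cov [IsGaussian γ] (M L : StrongDual ℝ E) :
    covarianceBilinDual γ M L = cov[M, L; γ] :=
  covarianceBilinDual_eq_covariance IsGaussian.memLp_two_id M L

lemma covarianceBilinDual_self_eq_var [IsGaussian γ] (L : StrongDual ℝ E) :
    covarianceBilinDual γ L L = Var[L; γ] :=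
  covarianceBilinDual_self_eq_variance IsGaussian.memLp_two_id L

/-- Cauchy–Schwarz: the variance of `M + t • L` is a nonnegative quadratic polynomial in `t`, so its
discriminant is nonpositive. -/
lemma covarianceBilinDual_sq_le [IsGaussian γ] (M L : StrongDual ℝ E) :
    covarianceBilinDual γ M L ^ 2 ≤ covarianceBilinDual γ M M * covarianceBilinDual γ L L := by
  have key : ∀ t : ℝ, 0 ≤ covarianceBilinDual γ L L * (t * t)
      + (2 * covarianceBilinDual γ M L) * t + covarianceBilinDual γ M M := by
    intro t
    have := covarianceBilinDual_self_nonneg (μ := γ) (M + t • L)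
    simp only [map_add, map_smul, _root_.add_apply, _root_.smul_apply,
      smul_eq_mul] at this
    rw [covarianceBilinDual_comm L M] at this
    linarith
  have := discrim_le_zero key
  rw [discrim] at this
  linarith

lemma integrable_sub_smul_id [IsGaussian γ] (L : StrongDual ℝ E) :
    Integrable (fun v => (L v - γ[L]) • v) γ := by
  have h1 : MemLp (fun v => L v - γ[L]) 2 γ := (memLp_dual_two γ L).sub (memLp_const _)
  have h2 : MemLp (fun v : E => v) 2 γ := IsGaussian.memLp_two_id
  exact (h2.smul (r := 1) h1).integrable le_rfl

/-- `M` commutes with the Bochner integral defining `regVec`. If `L` is degenerate, Cauchy–Schwarz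
forces its covariance with `M` to vanish, so the identity survives the convention `0⁻¹ = 0`. -/
lemma apply_regVec_mul [IsGaussian γ] (M L : StrongDual ℝ E) :
    M (regVec γ L) * covarianceBilinDual γ L L = covarianceBilinDual γ M L := by
  have h1 : M (∫ v, (L v - γ[L]) • v ∂γ) = covarianceBilinDual γ M L := by
    rw [← M.integral_comp_comm (integrable_sub_smul_id γ L), covarianceBilinDual_apply
      IsGaussian.memLp_two_id]
    have i1 : Integrable (fun v => (L v - γ[L]) * M v) γ := by
      simpa using M.integrable_comp (integrable_sub_smul_id γ L)
    have i2 : Integrable (fun v => γ[M] * (L v - γ[L])) γ :=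
      (((IsGaussian.integrable_dual γ L).sub (integrable_const _)).const_mul _)
    have e : ∫ v, γ[M] * (L v - γ[L]) ∂γ = 0 := by
      rw [integral_const_mul, integral_sub (IsGaussian.integrable_dual γ L) (integrable_const _)]
      simp
    calc ∫ v, M ((L v - γ[L]) • v) ∂γ = ∫ v, (L v - γ[L]) * M v ∂γ := by simp
      _ = ∫ v, ((L v - γ[L]) * M v - γ[M] * (L v - γ[L])) ∂γ := by
          rw [integral_sub i1 i2, e, sub_zero]
      _ = _ := by congr 1; ext v; ring
  rw [regVec, map_smul, h1, smul_eq_mul, covarianceBilinDual_self_eq_var]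
  by_cases hv : Var[L; γ] = 0
  · have := covarianceBilinDual_sq_le γ M L
    rw [covarianceBilinDual_self_eq_var γ L, hv, mul_zero] at this
    have h0 : covarianceBilinDual γ M L = 0 := by nlinarith
    simp [hv, h0]
  · field_simp

/-- The regression vector is determined by the covariance. -/
lemma apply_regVec [IsGaussian γ] (M L : StrongDual ℝ E) :
    M (regVec γ L) = (covarianceBilinDual γ L L)⁻¹ * covarianceBilinDual γ M L := by
  by_cases hv : covarianceBilinDual γ L L = 0
  · have : Var[L; γ] = 0 := by rw [← covarianceBilinDual_self_eq_var, hv]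
    simp [regVec, this, hv]
  · rw [← apply_regVec_mul γ M L]
    field_simp

/-- The residual map `v ↦ v - L v • k`, where `k` is the regression vector. -/
noncomputable def residual (L : StrongDual ℝ E) : E →L[ℝ] E :=
  ContinuousLinearMap.id ℝ E - L.smulRight (regVec γ L)

@[simp]
lemma residual_apply (L : StrongDual ℝ E) (v : E) : residual γ L v = v - L v • regVec γ L := rfl

/-- The residual and `L` are jointly Gaussian and, by the choice of the regression vector,
uncorrelated. -/
lemma indepFun_residual [IsGaussian γ] (L : StrongDual ℝ E) : IndepFun (residual γ L) L γ := by
  have hG : HasGaussianLaw (fun v => (residual γ L v, L v)) γ :=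
    ⟨isGaussian_map (μ := γ) ((residual γ L).prod L)⟩
  refine hG.indepFun_of_covariance_strongDual fun M N => ?_
  have e1 : M ∘ residual γ L = M.comp (residual γ L) := rfl
  have e2 : N ∘ L = N.comp L := rfl
  rw [e1, e2, ← covarianceBilinDual_eq_cov]
  have e3 : M.comp (residual γ L) = M - M (regVec γ L) • L := by
    ext v; simp [mul_comm]
  have e4 : N.comp L = N 1 • L := by
    ext v
    simpa [mul_comm] using (N.map_smul (L v) 1)
  rw [e3, e4]
  simp only [map_sub, map_smul, _root_.sub_apply, _root_.smul_apply,
    smul_eq_mul, apply_regVec_mul]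
  ring

/-- Disintegration of a Gaussian law along a functional. -/
lemma lintegral_eq_lintegral_lintegral_regVec [IsGaussian γ] (L : StrongDual ℝ E)
    {g : ℝ → E → ℝ≥0∞} (hg : Measurable (Function.uncurry g)) :
    ∫⁻ v, g (L v) v ∂γ = ∫⁻ v, ∫⁻ v', g (L v) (v' + (L v - L v') • regVec γ L) ∂γ ∂γ := by
  set k := regVec γ L
  have hind := (indepFun_iff_map_prod_eq_prod_map_map (by fun_prop) (by fun_prop)).1
    (indepFun_residual γ L)
  have hG : Measurable fun p : E × ℝ => g p.2 (p.1 + p.2 • k) :=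
    hg.comp (measurable_snd.prodMk (measurable_fst.add (measurable_snd.smul_const k)))
  calc ∫⁻ v, g (L v) v ∂γ
      = ∫⁻ v, (fun p : E × ℝ => g p.2 (p.1 + p.2 • k)) (residual γ L v, L v) ∂γ := by simp [k]
    _ = ∫⁻ p, g p.2 (p.1 + p.2 • k) ∂((γ.map (residual γ L)).prod (γ.map L)) := by
        rw [← hind, lintegral_map hG (by fun_prop)]
    _ = ∫⁻ l, ∫⁻ r, g l (r + l • k) ∂(γ.map (residual γ L)) ∂(γ.map L) := by
        rw [lintegral_prod_symm' _ hG]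
    _ = ∫⁻ v, ∫⁻ r, g (L v) (r + L v • k) ∂(γ.map (residual γ L)) ∂γ := by
        rw [lintegral_map (by exact hG.lintegral_prod_left') (by fun_prop)]
    _ = _ := by
        refine lintegral_congr fun v => ?_
        rw [lintegral_map (by exact hG.comp (by fun_prop : Measurable fun r : E => (r, L v)))
          (by fun_prop)]
        refine lintegral_congr fun v' => ?_
        simp only [residual_apply, k]
        congr 1
        module

end Regression

/-! ### Normalized reweighting of measures -/

section Weighted

variable {E : Type*} [MeasurableSpace E]

/-- The measure of density proportional to `w` with respect to `γ`, normalized. -/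
noncomputable def weighted (γ : Measure E) (w : E → ℝ≥0∞) : Measure E :=
  (∫⁻ v, w v ∂γ)⁻¹ • γ.withDensity w

variable {γ : Measure E} {w w' : E → ℝ≥0∞}

lemma lintegral_weighted (hw : Measurable w) {f : E → ℝ≥0∞} (hf : Measurable f) :
    ∫⁻ v, f v ∂(weighted γ w) = (∫⁻ v, w v ∂γ)⁻¹ * ∫⁻ v, w v * f v ∂γ := by
  rw [weighted, lintegral_smul_measure, lintegral_withDensity_eq_lintegral_mul _ hw hf]
  simp

lemma lintegral_mul_eq_mul_lintegral_weighted (hw : Measurable w) (h0 : ∫⁻ v, w v ∂γ ≠ 0)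
    (h1 : ∫⁻ v, w v ∂γ ≠ ⊤) {f : E → ℝ≥0∞} (hf : Measurable f) :
    ∫⁻ v, w v * f v ∂γ = (∫⁻ v, w v ∂γ) * ∫⁻ v, f v ∂(weighted γ w) := by
  rw [lintegral_weighted hw hf, ENNReal.mul_inv_cancel_left h0 h1]

/-- The bound also covers a total weight of zero or infinity, where the normalized measure vanishes.
Families of weighted laws are thus finite kernels without any exceptional set. -/
lemma weighted_univ_le (γ : Measure E) (w : E → ℝ≥0∞) : weighted γ w Set.univ ≤ 1 := by
  simp only [weighted, Measure.smul_apply, withDensity_apply _ MeasurableSet.univ,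
    Measure.restrict_univ, smul_eq_mul]
  exact ENNReal.inv_mul_le_one _

lemma lintegral_eq_of_withDensity_eq {K : ℝ≥0∞} {ρ : Measure E} [IsProbabilityMeasure ρ]
    (h : γ.withDensity w = K • ρ) : ∫⁻ v, w v ∂γ = K := by
  have := congrArg (fun μ => μ Set.univ) h
  simpa [withDensity_apply _ MeasurableSet.univ] using this

lemma weighted_eq_of_withDensity_eq {K : ℝ≥0∞} (h0 : K ≠ 0) (h1 : K ≠ ⊤) {ρ : Measure E}
    [IsProbabilityMeasure ρ] (h : γ.withDensity w = K • ρ) : weighted γ w = ρ := by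
  rw [weighted, lintegral_eq_of_withDensity_eq h, h, smul_smul, ENNReal.inv_mul_cancel h0 h1,
    one_smul]

lemma weighted_one (γ : Measure E) [IsProbabilityMeasure γ] : weighted γ (fun _ => 1) = γ := by
  simp [weighted]

lemma weighted_weighted (hw : Measurable w) (hw' : Measurable w') (h0 : ∫⁻ v, w v ∂γ ≠ 0)
    (h1 : ∫⁻ v, w v ∂γ ≠ ⊤) :
    weighted (weighted γ w) w' = weighted γ (fun v => w v * w' v) := by
  refine Measure.ext_of_lintegral _ fun f hf => ?_
  rw [lintegral_weighted hw' hf, lintegral_weighted hw hw',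
    lintegral_weighted hw (f := fun v => w' v * f v) (hw'.mul hf),
    lintegral_weighted (w := fun v => w v * w' v) (hw.mul hw') hf]
  have hi0 : (∫⁻ v, w v ∂γ)⁻¹ ≠ 0 := by simpa using h1
  have hi1 : (∫⁻ v, w v ∂γ)⁻¹ ≠ ⊤ := by simpa using h0
  rw [ENNReal.mul_inv (.inl hi0) (.inl hi1), inv_inv, mul_comm (∫⁻ v, w v ∂γ), mul_assoc,
    ENNReal.mul_inv_cancel_left h0 h1]
  simp only [mul_assoc]

end Weighted

/-! ### Reweighting a Gaussian vector along a functional -/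

section GaussianUpdate

variable {E : Type*} [NormedAddCommGroup E] [NormedSpace ℝ E] [CompleteSpace E]
  [MeasurableSpace E] [BorelSpace E] [SecondCountableTopology E]

/-- Polarization: a covariance formula need only be checked on variances. -/
lemma covarianceBilinDual_eq_of_self {γ : Measure E} {f : StrongDual ℝ E → StrongDual ℝ E → ℝ}
    (hf : ∀ M N, f (M + N) (M + N) = f M M + f N N + 2 * f M N)
    (h : ∀ M, covarianceBilinDual γ M M = f M M) (M N : StrongDual ℝ E) :
    covarianceBilinDual γ M N = f M N := by
  have := h (M + N)
  rw [hf] at this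
  simp only [map_add, _root_.add_apply] at this
  linarith [h M, h N, covarianceBilinDual_comm (μ := γ) M N]

/-- A Gaussian law weighted by the exponential of a concave quadratic polynomial of a functional is
a multiple of a Gaussian law, whose mean and covariance are explicit. -/
lemma exists_isGaussian_withDensity_expQuad (γ : Measure E) [IsGaussian γ] (L : StrongDual ℝ E)
    {q : ℝ} (hq : 0 ≤ q) (z h : ℝ) :
    ∃ ρ : Measure E, IsGaussian ρ
      ∧ γ.withDensity (fun v => expQuad q z h (L v))
        = ENNReal.ofReal (expQuadMass q z h (γ[L]) (covarianceBilinDual γ L L)) • ρ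
      ∧ (∀ M : StrongDual ℝ E, ρ[M] = γ[M] + covarianceBilinDual γ M L * (z - q * (γ[L] - h))
          / (1 + q * covarianceBilinDual γ L L))
      ∧ ∀ M N : StrongDual ℝ E, covarianceBilinDual ρ M N = covarianceBilinDual γ M N
          - q * covarianceBilinDual γ M L * covarianceBilinDual γ N L
            / (1 + q * covarianceBilinDual γ L L) := by
  set k := regVec γ L with hk
  set m := γ[L] with hm
  set s := covarianceBilinDual γ L L with hs
  have hs0 : 0 ≤ s := covarianceBilinDual_self_nonneg L
  have h1 : 0 < 1 + q * s := by positivity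
  have hvar : Var[L; γ] = s := (covarianceBilinDual_self_eq_var γ L).symm
  have hcov : ∀ M : StrongDual ℝ E, covarianceBilinDual γ M L = M k * s := fun M =>
    (apply_regVec_mul γ M L).symm
  have hLk : L k * s = s := (hcov L).symm
  set m' := m + s * (z - q * (m - h)) / (1 + q * s) with hm'
  set s' : ℝ≥0 := (s / (1 + q * s)).toNNReal with hs'
  have hs'r : (s' : ℝ) = s / (1 + q * s) := Real.coe_toNNReal _ (by positivity)
  set N := gaussianReal m' s' with hN
  -- The weight only sees `L v`. The residual is kept, and the component along `k` is replaced by an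
  -- independent variable with the reweighted one-dimensional law `N`.
  let T : E × ℝ →L[ℝ] E := (residual γ L).comp (ContinuousLinearMap.fst ℝ E ℝ)
    + (ContinuousLinearMap.snd ℝ E ℝ).smulRight k
  have hT : ∀ p, T p = p.1 + (p.2 - L p.1) • k := fun p => by
    simp only [T, _root_.add_apply, ContinuousLinearMap.comp_apply, ContinuousLinearMap.coe_fst',
      residual_apply, ContinuousLinearMap.smulRight_apply, ContinuousLinearMap.coe_snd', ← hk]
    module
  have hA : ∀ M : StrongDual ℝ E, M ∘ T
      = (fun p : E × ℝ => (M.comp (residual γ L)) p.1) + (fun p : E × ℝ => M k * p.2) := fun M => by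
    ext p
    simp only [Function.comp_apply, hT, Pi.add_apply, ContinuousLinearMap.comp_apply,
      residual_apply, map_add, map_smul, map_sub, smul_eq_mul, ← hk]
    ring
  have hres : ∀ M : StrongDual ℝ E, M.comp (residual γ L) = M - M k • L := fun M => by
    ext v; simp [mul_comm, hk]
  have hsnd : ∀ c : ℝ, MemLp (fun p : E × ℝ => c * p.2) 2 (γ.prod N) := fun c =>
    IsGaussian.memLp_dual (γ.prod N) (c • ContinuousLinearMap.snd ℝ E ℝ) 2 (by simp)
  have hfst : ∀ M : StrongDual ℝ E, MemLp (fun p : E × ℝ => M p.1) 2 (γ.prod N) := fun M =>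
    IsGaussian.memLp_dual (γ.prod N) (M.comp (ContinuousLinearMap.fst ℝ E ℝ)) 2 (by simp)
  have hρ : IsGaussian ((γ.prod N).map T) := isGaussian_map T
  refine ⟨(γ.prod N).map T, hρ, ?_, ?_, ?_⟩
  · refine Measure.ext_of_lintegral _ fun f hf => ?_
    have hmk : Measurable fun p : ℝ × E => p.2 + (p.1 - L p.2) • k := by fun_prop
    have hg : Measurable (Function.uncurry fun (l : ℝ) (v : E) => expQuad q z h l * f v) := by
      have : Measurable fun p : ℝ × E => expQuad q z h p.1 := by fun_prop
      exact this.mul (hf.comp measurable_snd)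
    have hG : Measurable fun l : ℝ => ∫⁻ v, f (v + (l - L v) • k) ∂γ :=
      (hf.comp hmk).lintegral_prod_right'
    have hwm : Measurable (expQuad q z h) := by fun_prop
    rw [lintegral_withDensity_eq_lintegral_mul _ (by fun_prop) hf, lintegral_smul_measure,
      lintegral_map hf (by fun_prop),
      lintegral_prod_symm' (fun p => f (T p)) (hf.comp (by fun_prop))]
    simp only [Pi.mul_apply, hT]
    rw [lintegral_eq_lintegral_lintegral_regVec γ L hg]
    calc ∫⁻ v, ∫⁻ v', expQuad q z h (L v) * f (v' + (L v - L v') • k) ∂γ ∂γ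
        = ∫⁻ v, expQuad q z h (L v) * ∫⁻ v', f (v' + (L v - L v') • k) ∂γ ∂γ := by
          refine lintegral_congr fun v => ?_
          rw [lintegral_const_mul]
          exact hf.comp (hmk.comp measurable_prodMk_left)
      _ = ∫⁻ l, expQuad q z h l * ∫⁻ v', f (v' + (l - L v') • k) ∂γ ∂(γ.map L) := by
          exact (lintegral_map (hwm.mul hG) (by fun_prop)).symm
      _ = ∫⁻ l, ∫⁻ v', f (v' + (l - L v') • k) ∂γ ∂((γ.map L).withDensity (expQuad q z h)) := by
          rw [lintegral_withDensity_eq_lintegral_mul _ hwm hG]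
          rfl
      _ = _ := by
          rw [IsGaussian.map_eq_gaussianReal L, gaussianReal_withDensity_expQuad _ _ hq,
            lintegral_smul_measure, hvar, Real.coe_toNNReal _ hs0]
  · intro M
    rw [integral_map (by fun_prop) (by fun_prop)]
    have e : ∀ p, M (T p) = (M.comp (residual γ L)) p.1 + M k * p.2 := fun p => congrFun (hA M) p
    simp only [e]
    rw [integral_add ((hfst _).integrable (by simp)) ((hsnd _).integrable (by simp)),
      integral_const_mul, integral_fun_fst (μ := γ) (ν := N) (fun v => (M.comp (residual γ L)) v),
      integral_fun_snd (μ := γ) (ν := N) (fun l : ℝ => l), hN, integral_id_gaussianReal]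
    simp only [hres, probReal_univ, smul_eq_mul, one_mul, _root_.sub_apply, _root_.smul_apply]
    rw [integral_sub (IsGaussian.integrable_dual γ M)
      ((IsGaussian.integrable_dual γ L).const_mul _), integral_const_mul, ← hm, hcov, hm']
    field_simp
    ring
  · refine covarianceBilinDual_eq_of_self (f := fun M N => covarianceBilinDual γ M N
      - q * covarianceBilinDual γ M L * covarianceBilinDual γ N L / (1 + q * s))
      (fun M N => ?_) fun M => ?_
    · simp only [map_add, _root_.add_apply, covarianceBilinDual_comm N M]
      ring
    · rw [covarianceBilinDual_self_eq_var, variance_map (by fun_prop) (by fun_prop), hA,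
        IndepFun.variance_add (hfst _) (hsnd _)
          (indepFun_prod (X := fun v => (M.comp (residual γ L)) v) (Y := fun l : ℝ => M k * l)
            (by fun_prop) (by fun_prop))]
      have e1 : Var[fun p : E × ℝ => (M.comp (residual γ L)) p.1; γ.prod N]
          = Var[M.comp (residual γ L); γ] := by
        have := variance_map (μ := γ.prod N) (Y := Prod.fst) (X := M.comp (residual γ L))
          (by fun_prop) (by fun_prop)
        rw [← Measure.fst, Measure.fst_prod] at this
        exact this.symm
      have e2 : Var[fun p : E × ℝ => M k * p.2; γ.prod N] = (M k) ^ 2 * s' := by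
        rw [variance_const_mul, ← variance_fun_id_gaussianReal (μ := m') (v := s'), ← hN]
        have := variance_map (μ := γ.prod N) (Y := Prod.snd) (X := fun l : ℝ => l)
          (by fun_prop) (by fun_prop)
        rw [← Measure.snd, Measure.snd_prod] at this
        rw [this]
        rfl
      rw [e1, e2, ← covarianceBilinDual_self_eq_var, hres, hs'r]
      simp only [map_sub, map_smul, _root_.sub_apply, _root_.smul_apply, smul_eq_mul, hcov,
        covarianceBilinDual_comm L M, hLk]
      field_simp
      ring

end GaussianUpdate

/-! ### Conditioning a Gaussian vector on a functional -/

section GaussianConditioning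

variable {E : Type*} [NormedAddCommGroup E] [NormedSpace ℝ E] [CompleteSpace E]
  [MeasurableSpace E] [BorelSpace E] [SecondCountableTopology E]

/-- The conditional law of `v` given `L v = z` when `v` has the Gaussian law `γ`. -/
noncomputable def condOn (γ : Measure E) (L : StrongDual ℝ E) (z : ℝ) : Measure E :=
  γ.map fun v => v + (z - L v) • regVec γ L

lemma condOn_eq_map (γ : Measure E) (L : StrongDual ℝ E) (z : ℝ) :
    condOn γ L z = (γ.map (residual γ L)).map (fun v => v + z • regVec γ L) := by
  rw [Measure.map_map (by fun_prop) (by fun_prop), condOn]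
  congr 1
  ext v
  simp only [Function.comp_apply, residual_apply]
  module

instance isGaussian_condOn (γ : Measure E) [IsGaussian γ] (L : StrongDual ℝ E) (z : ℝ) :
    IsGaussian (condOn γ L z) := by
  rw [condOn_eq_map]
  infer_instance

lemma covarianceBilinDual_condOn (γ : Measure E) [IsGaussian γ] (L : StrongDual ℝ E) (z : ℝ)
    (M N : StrongDual ℝ E) :
    covarianceBilinDual (condOn γ L z) M N = covarianceBilinDual γ M N
      - (covarianceBilinDual γ L L)⁻¹ * covarianceBilinDual γ M L * covarianceBilinDual γ N L := by
  refine covarianceBilinDual_eq_of_self (f := fun M N => covarianceBilinDual γ M N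
      - (covarianceBilinDual γ L L)⁻¹ * covarianceBilinDual γ M L * covarianceBilinDual γ N L)
      (fun M N => ?_) (fun M => ?_) M N
  · simp only [map_add, _root_.add_apply, covarianceBilinDual_comm N M]
    ring
  · have hres : M.comp (residual γ L) = M - M (regVec γ L) • L := by
      ext v; simp [mul_comm]
    have e : M ∘ (fun v => v + z • regVec γ L) ∘ residual γ L
        = fun v => (M.comp (residual γ L)) v + M (z • regVec γ L) := by ext v; simp
    rw [covarianceBilinDual_self_eq_var, condOn_eq_map,
      Measure.map_map (by fun_prop) (by fun_prop), variance_map (by fun_prop) (by fun_prop), e,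
      variance_add_const (by fun_prop), ← covarianceBilinDual_self_eq_var, hres]
    have hk := apply_regVec_mul γ M L
    rw [apply_regVec] at hk
    simp only [map_sub, map_smul, _root_.sub_apply, _root_.smul_apply, smul_eq_mul,
      covarianceBilinDual_comm L M, apply_regVec γ M L]
    linear_combination (covarianceBilinDual γ L L)⁻¹ * covarianceBilinDual γ M L * hk

lemma lintegral_eq_lintegral_lintegral_condOn (γ : Measure E) [IsGaussian γ] (L : StrongDual ℝ E)
    {g : ℝ → E → ℝ≥0∞} (hg : Measurable (Function.uncurry g)) :
    ∫⁻ v, g (L v) v ∂γ = ∫⁻ v, ∫⁻ v', g (L v) v' ∂(condOn γ L (L v)) ∂γ := by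
  rw [lintegral_eq_lintegral_lintegral_regVec γ L hg]
  refine lintegral_congr fun v => ?_
  rw [condOn, lintegral_map (by exact hg.comp measurable_prodMk_left) (by fun_prop)]

end GaussianConditioning

/-! ### Iterated reweighting -/

section ProductWeight

variable {E : Type*} [NormedAddCommGroup E] [NormedSpace ℝ E] [CompleteSpace E]
  [MeasurableSpace E] [BorelSpace E] [SecondCountableTopology E]

section OneStep

variable (γ : Measure E) [IsGaussian γ] (L : StrongDual ℝ E) {q : ℝ} (hq : 0 ≤ q) (z h : ℝ)

include hq

lemma lintegral_expQuad_dual :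
    ∫⁻ v, expQuad q z h (L v) ∂γ
      = ENNReal.ofReal (expQuadMass q z h (γ[L]) (covarianceBilinDual γ L L)) := by
  obtain ⟨ρ, hρ, h1, -, -⟩ := exists_isGaussian_withDensity_expQuad γ L hq z h
  exact lintegral_eq_of_withDensity_eq h1

lemma lintegral_expQuad_dual_ne_zero : ∫⁻ v, expQuad q z h (L v) ∂γ ≠ 0 := by
  rw [lintegral_expQuad_dual γ L hq]
  simpa using expQuadMass_pos hq (covarianceBilinDual_self_nonneg L) z h _

lemma lintegral_expQuad_dual_ne_top : ∫⁻ v, expQuad q z h (L v) ∂γ ≠ ⊤ := by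
  rw [lintegral_expQuad_dual γ L hq]
  exact ENNReal.ofReal_ne_top

lemma weighted_expQuad_spec :
    IsGaussian (weighted γ fun v => expQuad q z h (L v))
      ∧ (∀ M : StrongDual ℝ E, (weighted γ fun v => expQuad q z h (L v))[M] = γ[M]
          + covarianceBilinDual γ M L * (z - q * (γ[L] - h))
          / (1 + q * covarianceBilinDual γ L L))
      ∧ ∀ M N : StrongDual ℝ E, covarianceBilinDual (weighted γ fun v => expQuad q z h (L v)) M N
          = covarianceBilinDual γ M N - q * covarianceBilinDual γ M L * covarianceBilinDual γ N L
            / (1 + q * covarianceBilinDual γ L L) := by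
  have h0 := lintegral_expQuad_dual_ne_zero γ L hq z h
  have ht := lintegral_expQuad_dual_ne_top γ L hq z h
  rw [lintegral_expQuad_dual γ L hq] at h0 ht
  obtain ⟨ρ, hρ, h1, h2, h3⟩ := exists_isGaussian_withDensity_expQuad γ L hq z h
  rw [weighted_eq_of_withDensity_eq h0 ht h1]
  exact ⟨hρ, h2, h3⟩

/-- By Cauchy–Schwarz the updated variance is at least the old one divided by `1 + q Var L`: a noisy
observation never makes a variance vanish. -/
lemma covarianceBilinDual_weighted_expQuad_pos {M : StrongDual ℝ E}
    (hM : 0 < covarianceBilinDual γ M M) :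
    0 < covarianceBilinDual (weighted γ fun v => expQuad q z h (L v)) M M := by
  rw [(weighted_expQuad_spec γ L hq z h).2.2]
  have h1 : 0 ≤ covarianceBilinDual γ L L := covarianceBilinDual_self_nonneg L
  have h2 : 0 < 1 + q * covarianceBilinDual γ L L := by positivity
  have h3 := mul_le_mul_of_nonneg_left (covarianceBilinDual_sq_le γ M L) hq
  rw [sub_pos, div_lt_iff₀ h2]
  nlinarith

end OneStep

/-- The product of the weights `expQuad (Q s) (z s) (h s) (ℓ s v)` over `1 ≤ s ≤ n`. -/
noncomputable def prodWeight (Q z h : ℕ → ℝ) (ℓ : ℕ → StrongDual ℝ E) (n : ℕ) (v : E) : ℝ≥0∞ :=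
  ∏ s ∈ Finset.Icc 1 n, expQuad (Q s) (z s) (h s) (ℓ s v)

@[fun_prop]
lemma Measurable.prodWeight (Q z h : ℕ → ℝ) (ℓ : ℕ → StrongDual ℝ E) (n : ℕ) :
    Measurable (prodWeight Q z h ℓ n) := by
  unfold LEGFilter.prodWeight
  fun_prop

lemma prodWeight_zero (Q z h : ℕ → ℝ) (ℓ : ℕ → StrongDual ℝ E) :
    prodWeight Q z h ℓ 0 = fun _ => 1 := by
  ext v; simp [prodWeight]

lemma prodWeight_succ (Q z h : ℕ → ℝ) (ℓ : ℕ → StrongDual ℝ E) (n : ℕ) :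
    prodWeight Q z h ℓ (n + 1) = fun v => prodWeight Q z h ℓ n v
      * expQuad (Q (n + 1)) (z (n + 1)) (h (n + 1)) (ℓ (n + 1) v) := by
  ext v
  simp [prodWeight, Finset.prod_Icc_succ_top]

variable {Q : ℕ → ℝ} (hQ : ∀ t, 1 ≤ t → 0 ≤ Q t) (z h : ℕ → ℝ) (ℓ : ℕ → StrongDual ℝ E)

include hQ

lemma weighted_prodWeight_spec (γ : Measure E) [IsGaussian γ] (n : ℕ) :
    IsGaussian (weighted γ (prodWeight Q z h ℓ n)) ∧ ∫⁻ v, prodWeight Q z h ℓ n v ∂γ ≠ 0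
      ∧ ∫⁻ v, prodWeight Q z h ℓ n v ∂γ ≠ ⊤ := by
  induction n with
  | zero => rw [prodWeight_zero, weighted_one]; simp; infer_instance
  | succ n ih =>
    obtain ⟨h1, h2, h3⟩ := ih
    have hq := hQ (n + 1) (by omega)
    rw [prodWeight_succ, ← weighted_weighted (by fun_prop) (by fun_prop) h2 h3,
      lintegral_mul_eq_mul_lintegral_weighted (by fun_prop) h2 h3 (by fun_prop)]
    exact ⟨(weighted_expQuad_spec _ _ hq _ _).1,
      mul_ne_zero h2 (lintegral_expQuad_dual_ne_zero _ _ hq _ _),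
      ENNReal.mul_ne_top h3 (lintegral_expQuad_dual_ne_top _ _ hq _ _)⟩

lemma weighted_prodWeight_succ (γ : Measure E) [IsGaussian γ] (n : ℕ) :
    weighted γ (prodWeight Q z h ℓ (n + 1)) = weighted (weighted γ (prodWeight Q z h ℓ n))
      fun v => expQuad (Q (n + 1)) (z (n + 1)) (h (n + 1)) (ℓ (n + 1) v) := by
  obtain ⟨-, h2, h3⟩ := weighted_prodWeight_spec hQ z h ℓ γ n
  rw [prodWeight_succ, ← weighted_weighted (by fun_prop) (by fun_prop) h2 h3]

/-- The covariance update contains neither the mean nor `z` nor `h`, so equality of covariances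
propagates. This is what allows the auxiliary observations to be replaced by zero in the variances,
and what makes the variances deterministic for a Gaussian pair. -/
lemma covarianceBilinDual_weighted_prodWeight_congr {γ₁ γ₂ : Measure E} [IsGaussian γ₁]
    [IsGaussian γ₂] (hγ : ∀ M N, covarianceBilinDual γ₁ M N = covarianceBilinDual γ₂ M N)
    (z' h' : ℕ → ℝ) (n : ℕ) (M N : StrongDual ℝ E) :
    covarianceBilinDual (weighted γ₁ (prodWeight Q z h ℓ n)) M N
      = covarianceBilinDual (weighted γ₂ (prodWeight Q z' h' ℓ n)) M N := by
  induction n generalizing M N with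
  | zero => rw [prodWeight_zero, weighted_one, prodWeight_zero, weighted_one, hγ]
  | succ n ih =>
    have hq := hQ (n + 1) (by omega)
    have g1 := (weighted_prodWeight_spec hQ z h ℓ γ₁ n).1
    have g2 := (weighted_prodWeight_spec hQ z' h' ℓ γ₂ n).1
    rw [weighted_prodWeight_succ hQ, weighted_prodWeight_succ hQ,
      (weighted_expQuad_spec _ _ hq _ _).2.2, (weighted_expQuad_spec _ _ hq _ _).2.2]
    simp only [ih]

lemma covarianceBilinDual_weighted_prodWeight_pos (γ : Measure E) [IsGaussian γ] (n : ℕ)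
    {M : StrongDual ℝ E} (hM : 0 < covarianceBilinDual γ M M) :
    0 < covarianceBilinDual (weighted γ (prodWeight Q z h ℓ n)) M M := by
  induction n with
  | zero => rwa [prodWeight_zero, weighted_one]
  | succ n ih =>
    have g1 := (weighted_prodWeight_spec hQ z h ℓ γ n).1
    rw [weighted_prodWeight_succ hQ]
    exact covarianceBilinDual_weighted_expQuad_pos _ _ (hQ _ (by omega)) _ _ ih

/-- Removing the linear terms of the weights shifts the mean by a covariance. -/
lemma integral_weighted_prodWeight_zero (γ : Measure E) [IsGaussian γ] (n : ℕ)
    (M : StrongDual ℝ E) :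
    (weighted γ (prodWeight Q 0 h ℓ n))[M] = (weighted γ (prodWeight Q z h ℓ n))[M]
      - covarianceBilinDual (weighted γ (prodWeight Q z h ℓ n)) M
        (∑ s ∈ Finset.Icc 1 n, z s • ℓ s) := by
  obtain ⟨g, h0, h1⟩ := weighted_prodWeight_spec hQ z h ℓ γ n
  -- The linear terms are cancelled by one further weight, with quadratic coefficient `0` and linear
  -- coefficient `-1`. For this weight the mean update reduces to subtracting a covariance.
  have e : prodWeight Q 0 h ℓ n = fun v => prodWeight Q z h ℓ n v
      * expQuad 0 (-1) (∑ s ∈ Finset.Icc 1 n, z s * h s)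
        ((∑ s ∈ Finset.Icc 1 n, z s • ℓ s : StrongDual ℝ E) v) := by
    ext v
    simp only [prodWeight, expQuad, Pi.zero_apply]
    rw [← ENNReal.ofReal_prod_of_nonneg (fun _ _ => (Real.exp_pos _).le),
      ← ENNReal.ofReal_prod_of_nonneg (fun _ _ => (Real.exp_pos _).le),
      ← ENNReal.ofReal_mul (Finset.prod_nonneg fun _ _ => (Real.exp_pos _).le),
      ← Real.exp_sum, ← Real.exp_sum, ← Real.exp_add]
    congr 2
    simp only [FunLike.coe_sum, Finset.sum_apply, _root_.smul_apply, smul_eq_mul]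
    rw [← Finset.sum_sub_distrib, zero_mul, zero_div, sub_zero, neg_one_mul,
      ← sub_eq_add_neg, ← Finset.sum_sub_distrib]
    exact Finset.sum_congr rfl fun s _ => by ring
  rw [e, ← weighted_weighted (by fun_prop) (by fun_prop) h0 h1,
    (weighted_expQuad_spec _ _ le_rfl _ _).2.1]
  simp
  ring

end ProductWeight

/-! ### Measurable dependence on a family of measures -/

section KernelMeasurability

variable {α E : Type*} [MeasurableSpace α]

section

variable [MeasurableSpace E] {κ : α → Measure E} (hκ : Measurable κ)
  (hκ1 : ∀ a, κ a Set.univ ≤ 1)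

include hκ hκ1

lemma measurable_lintegral_family {F : α × E → ℝ≥0∞} (hF : Measurable F) :
    Measurable fun a => ∫⁻ v, F (a, v) ∂κ a := by
  let K : Kernel α E := ⟨κ, hκ⟩
  have : IsFiniteKernel K := ⟨1, by simp, hκ1⟩
  exact hF.lintegral_kernel_prod_right' (κ := K)

lemma stronglyMeasurable_integral_family {G : Type*} [NormedAddCommGroup G] [NormedSpace ℝ G]
    {F : α × E → G} (hF : StronglyMeasurable F) :
    StronglyMeasurable fun a => ∫ v, F (a, v) ∂κ a := by
  let K : Kernel α E := ⟨κ, hκ⟩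
  have : IsFiniteKernel K := ⟨1, by simp, hκ1⟩
  exact hF.integral_kernel_prod_right' (κ := K)

lemma measurable_integral_family {F : α × E → ℝ} (hF : Measurable F) :
    Measurable fun a => ∫ v, F (a, v) ∂κ a :=
  (stronglyMeasurable_integral_family hκ hκ1 hF.stronglyMeasurable).measurable

lemma measurable_weighted {w : α → E → ℝ≥0∞} (hw : Measurable (Function.uncurry w)) :
    Measurable fun a => weighted (κ a) (w a) := by
  refine Measure.measurable_of_measurable_coe _ fun s hs => ?_
  have e : ∀ a, weighted (κ a) (w a) s
      = (∫⁻ v, w a v ∂κ a)⁻¹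
        * ∫⁻ v, (Set.univ ×ˢ s).indicator (Function.uncurry w) (a, v) ∂κ a := by
    intro a
    rw [weighted, Measure.smul_apply, withDensity_apply _ hs, ← lintegral_indicator hs]
    congr 1
    refine lintegral_congr fun v => ?_
    by_cases hv : v ∈ s <;> simp [hv]
  simp only [e]
  exact (measurable_lintegral_family hκ hκ1 hw).inv.mul
    (measurable_lintegral_family hκ hκ1 (hw.indicator (MeasurableSet.univ.prod hs)))

lemma measurable_variance_family {f : E → ℝ} (hf : Measurable f) :
    Measurable fun a => Var[f; κ a] := by
  simp only [variance, evariance]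
  refine Measurable.ennreal_toReal
    (measurable_lintegral_family hκ hκ1 (F := fun p => ‖f p.2 - ∫ v, f v ∂κ p.1‖ₑ ^ 2) ?_)
  have := measurable_integral_family hκ hκ1 (F := fun p => f p.2) (by fun_prop)
  exact (((hf.comp measurable_snd).sub (this.comp measurable_fst)).enorm).pow_const 2

end

variable [NormedAddCommGroup E] [NormedSpace ℝ E] [CompleteSpace E]
  [MeasurableSpace E] [BorelSpace E] [SecondCountableTopology E]
  {κ : α → Measure E} (hκ : Measurable κ) (hκ1 : ∀ a, κ a Set.univ ≤ 1)

include hκ hκ1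

lemma measurable_regVec (L : StrongDual ℝ E) : Measurable fun a => regVec (κ a) L := by
  have h1 := measurable_integral_family hκ hκ1 (F := fun p => L p.2) (by fun_prop)
  have h2 : Measurable fun p : α × E => (L p.2 - ∫ v, L v ∂κ p.1) • p.2 :=
    ((L.measurable.comp measurable_snd).sub (h1.comp measurable_fst)).smul measurable_snd
  exact (measurable_variance_family hκ hκ1 (f := L) (by fun_prop)).inv.smul
    (stronglyMeasurable_integral_family hκ hκ1 h2.stronglyMeasurable).measurable

lemma measurable_condOn (L : StrongDual ℝ E) :
    Measurable fun p : α × ℝ => condOn (κ p.1) L p.2 := by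
  have hr := measurable_regVec hκ hκ1 L
  refine Measure.measurable_of_measurable_coe _ fun s hs => ?_
  have hf : Measurable fun p : (α × ℝ) × E => p.2 + (p.1.2 - L p.2) • regVec (κ p.1.1) L := by
    have : Measurable fun p : (α × ℝ) × E => regVec (κ p.1.1) L :=
      hr.comp (measurable_fst.comp measurable_fst)
    exact measurable_snd.add (((measurable_snd.comp measurable_fst).sub
      (L.measurable.comp measurable_snd)).smul this)
  have e : ∀ p : α × ℝ, condOn (κ p.1) L p.2 s = ∫⁻ v, ((fun p : (α × ℝ) × E =>
      p.2 + (p.1.2 - L p.2) • regVec (κ p.1.1) L) ⁻¹' s).indicator 1 (p, v) ∂κ p.1 := by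
    intro p
    rw [condOn, Measure.map_apply (by fun_prop) hs,
      ← lintegral_indicator_one ((by fun_prop : Measurable _) hs)]
    rfl
  simp only [e]
  exact measurable_lintegral_family (hκ.comp measurable_fst) (fun p => hκ1 p.1)
    (measurable_one.indicator (hf hs))

end KernelMeasurability

lemma condOn_univ {E : Type*} [NormedAddCommGroup E] [NormedSpace ℝ E] [CompleteSpace E]
    [MeasurableSpace E] [BorelSpace E] [SecondCountableTopology E] (γ : Measure E)
    (L : StrongDual ℝ E) (z : ℝ) : condOn γ L z Set.univ = γ Set.univ := by
  rw [condOn, Measure.map_apply (by fun_prop) MeasurableSet.univ, Set.preimage_univ]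

/-! ### Regular conditional laws -/

section CondMean

variable {Ω : Type*} {m mΩ : MeasurableSpace Ω} {P : Measure Ω}

lemma measurable_condMean (f : Ω → ℝ) : Measurable[m] (condMean m P f) :=
  (measurable_condLExp m P _).ennreal_toReal.sub (measurable_condLExp m P _).ennreal_toReal

end CondMean

/-- `κ` is a regular version of the conditional law of `V` given the σ-algebra `m`. -/
structure IsCondLaw {Ω E : Type*} (m : MeasurableSpace Ω) {mΩ : MeasurableSpace Ω} (P : Measure Ω)
    [mE : MeasurableSpace E] (V : Ω → E) (κ : Ω → Measure E) : Prop where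
  measurable : Measurable[m] κ
  mass_le : ∀ ω, κ ω Set.univ ≤ 1
  lintegral_eq : ∀ F : Ω × E → ℝ≥0∞, Measurable[m.prod mE] F →
    ∫⁻ ω, F (ω, V ω) ∂P = ∫⁻ ω, ∫⁻ v, F (ω, v) ∂κ ω ∂P

namespace IsCondLaw

section Basic

variable {Ω E : Type*} {m mΩ : MeasurableSpace Ω} {P : Measure Ω} [IsProbabilityMeasure P]
  [mE : MeasurableSpace E] {V : Ω → E} {κ : Ω → Measure E}

/-- The defining identity of `IsCondLaw`, tested on `F` restricted to `s ×ˢ univ`, is the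
characterization of the conditional expectation on the event `s`. -/
lemma condLExp_ae_eq (h : IsCondLaw m P V κ) (hm : m ≤ mΩ) {F : Ω × E → ℝ≥0∞}
    (hF : Measurable[m.prod mE] F) :
    condLExp m P (fun ω => F (ω, V ω)) =ᵐ[P] fun ω => ∫⁻ v, F (ω, v) ∂κ ω := by
  refine (ae_eq_condLExp hm P _ ?_ fun s hs => ?_).symm
  · exact @measurable_lintegral_family Ω E m mE κ h.measurable h.mass_le F hF
  · have hs' : MeasurableSet[m.prod mE] (s ×ˢ (Set.univ : Set E)) :=
      @MeasurableSet.prod Ω E m mE _ _ hs MeasurableSet.univ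
    have key := h.lintegral_eq _ (hF.indicator hs')
    rw [← lintegral_indicator (hm s hs), ← lintegral_indicator (hm s hs)]
    calc _ = ∫⁻ ω, ∫⁻ v, (s ×ˢ Set.univ).indicator F (ω, v) ∂κ ω ∂P := by
          refine lintegral_congr fun ω => ?_
          by_cases hω : ω ∈ s <;> simp [hω, Set.indicator]
      _ = _ := key.symm
      _ = _ := by
          refine lintegral_congr fun ω => ?_
          by_cases hω : ω ∈ s <;> simp [hω, Set.indicator]

lemma condIntegrable_and_condMean_ae_eq (h : IsCondLaw m P V κ) (hm : m ≤ mΩ) {F : Ω × E → ℝ}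
    (hF : Measurable[m.prod mE] F) (hi : ∀ᵐ ω ∂P, Integrable (fun v => F (ω, v)) (κ ω)) :
    CondIntegrable m P (fun ω => F (ω, V ω))
      ∧ condMean m P (fun ω => F (ω, V ω)) =ᵐ[P] fun ω => ∫ v, F (ω, v) ∂κ ω := by
  have h1 := h.condLExp_ae_eq hm (F := fun p => ENNReal.ofReal |F p|)
    (@Measurable.ennreal_ofReal _ (m.prod mE) _ (measurable_norm.comp hF))
  have h2 := h.condLExp_ae_eq hm (F := fun p => ENNReal.ofReal (F p))
    (@Measurable.ennreal_ofReal _ (m.prod mE) _ hF)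
  have h3 := h.condLExp_ae_eq hm (F := fun p => ENNReal.ofReal (-F p))
    (@Measurable.ennreal_ofReal _ (m.prod mE) _ (measurable_neg.comp hF))
  constructor
  · filter_upwards [h1, hi] with ω a b
    rw [a]
    simpa [← Real.norm_eq_abs] using b.norm.lintegral_lt_top
  · filter_upwards [h2, h3, hi] with ω a b c
    rw [condMean, a, b, integral_eq_lintegral_pos_part_sub_lintegral_neg_part c]

lemma congr (h : IsCondLaw m P V κ) {κ' : Ω → Measure E} (h' : κ =ᵐ[P] κ')
    (hm' : Measurable[m] κ') (hle : ∀ ω, κ' ω Set.univ ≤ 1) : IsCondLaw m P V κ' :=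
  ⟨hm', hle, fun F hF => by
    rw [h.lintegral_eq F hF]
    refine lintegral_congr_ae ?_
    filter_upwards [h'] with ω hω using by rw [hω]⟩

/-- A function measurable for `σ(A)` times the σ-algebra of `E` factors through `(A, id)`, so test
functions on `𝔸 × E` suffice. -/
lemma of_comap {𝔸 : Type*} [m𝔸 : MeasurableSpace 𝔸] (A : Ω → 𝔸) {κ : 𝔸 → Measure E}
    (hκ : Measurable κ) (hκ1 : ∀ a, κ a Set.univ ≤ 1)
    (h : ∀ Φ : 𝔸 × E → ℝ≥0∞, Measurable Φ →
      ∫⁻ ω, Φ (A ω, V ω) ∂P = ∫⁻ ω, ∫⁻ v, Φ (A ω, v) ∂κ (A ω) ∂P) :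
    IsCondLaw (MeasurableSpace.comap A m𝔸) P V (fun ω => κ (A ω)) := by
  refine ⟨hκ.comp (comap_measurable A), fun ω => hκ1 _, fun F hF => ?_⟩
  have e : (MeasurableSpace.comap A m𝔸).prod mE
      = MeasurableSpace.comap (Prod.map A id) (m𝔸.prod mE) := by
    simp only [MeasurableSpace.prod, MeasurableSpace.comap_sup, MeasurableSpace.comap_comp]
    rfl
  rw [e] at hF
  obtain ⟨Φ, hΦ, rfl⟩ := hF.exists_eq_measurable_comp
  exact h Φ hΦ

/-- `m ⊔ σ(Z)` is the pullback of the product σ-algebra under `ω ↦ (ω, Z ω)`, which reduces the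
claim to `of_comap`. -/
lemma of_sup_comap {𝔹 : Type*} [m𝔹 : MeasurableSpace 𝔹] (Z : Ω → 𝔹) {κ : Ω × 𝔹 → Measure E}
    (hκ : Measurable[m.prod m𝔹] κ) (hκ1 : ∀ a, κ a Set.univ ≤ 1)
    (h : ∀ Φ : (Ω × 𝔹) × E → ℝ≥0∞, Measurable[(m.prod m𝔹).prod mE] Φ →
      ∫⁻ ω, Φ ((ω, Z ω), V ω) ∂P = ∫⁻ ω, ∫⁻ v, Φ ((ω, Z ω), v) ∂κ (ω, Z ω) ∂P) :
    IsCondLaw (m ⊔ MeasurableSpace.comap Z m𝔹) P V (fun ω => κ (ω, Z ω)) := by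
  have e : m ⊔ MeasurableSpace.comap Z m𝔹
      = MeasurableSpace.comap (fun ω => (ω, Z ω)) (m.prod m𝔹) := by
    simp only [MeasurableSpace.prod, MeasurableSpace.comap_sup, MeasurableSpace.comap_comp]
    change _ = MeasurableSpace.comap id m ⊔ MeasurableSpace.comap Z m𝔹
    rw [MeasurableSpace.comap_id]
  rw [e]
  exact of_comap (m𝔸 := m.prod m𝔹) (fun ω => (ω, Z ω)) hκ hκ1 h

lemma of_condDistrib {𝔸 : Type*} [m𝔸 : MeasurableSpace 𝔸] [StandardBorelSpace E] [Nonempty E]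
    {A : Ω → 𝔸} (hA : Measurable A) (hV : Measurable V) :
    IsCondLaw (MeasurableSpace.comap A m𝔸) P V (fun ω => condDistrib V A P (A ω)) := by
  refine of_comap A (Kernel.measurable _) (fun a => prob_le_one) fun Φ hΦ => ?_
  rw [← lintegral_map hΦ (hA.prodMk hV), ← compProd_map_condDistrib hV.aemeasurable,
    Measure.lintegral_compProd hΦ,
    lintegral_map (measurable_lintegral_family (Kernel.measurable _) (fun a => prob_le_one) hΦ) hA]

lemma of_bot [IsProbabilityMeasure (P.map V)] (hV : Measurable V) :
    IsCondLaw ⊥ P V (fun _ => P.map V) := by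
  have := of_comap (P := P) (V := V) (fun _ : Ω => ()) (κ := fun _ => P.map V) measurable_const
    (fun _ => prob_le_one) fun Φ hΦ => by
      rw [lintegral_const, measure_univ, mul_one,
        lintegral_map (f := fun v => Φ ((), v)) (hΦ.comp measurable_prodMk_left) hV]
  rwa [MeasurableSpace.comap_const] at this

lemma of_indep_comap {𝔸 : Type*} [m𝔸 : MeasurableSpace 𝔸] {A : Ω → 𝔸} (hA : Measurable A)
    {W : Ω → E} (hW : Measurable W) {ρ : Measure E} [IsProbabilityMeasure ρ] (hρ : P.map W = ρ)
    (hi : Indep (MeasurableSpace.comap A m𝔸) (MeasurableSpace.comap W mE) P) :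
    IsCondLaw (MeasurableSpace.comap A m𝔸) P W (fun _ => ρ) := by
  refine of_comap A (κ := fun _ => ρ) measurable_const (fun _ => prob_le_one) fun Φ hΦ => ?_
  have := Measure.isProbabilityMeasure_map (μ := P) hA.aemeasurable
  have h1 := (indepFun_iff_map_prod_eq_prod_map_map hA.aemeasurable hW.aemeasurable).1
    ((IndepFun_iff_Indep _ _ _).2 hi)
  rw [← lintegral_map hΦ (hA.prodMk hW), h1, hρ, lintegral_prod _ hΦ.aemeasurable,
    lintegral_map hΦ.lintegral_prod_right' hA]

lemma of_indep (hm : m ≤ mΩ) {W : Ω → E} (hW : Measurable W) {ρ : Measure E}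
    [IsProbabilityMeasure ρ] (hρ : P.map W = ρ)
    (hi : Indep m (MeasurableSpace.comap W mE) P) : IsCondLaw m P W (fun _ => ρ) := by
  have := of_indep_comap (m𝔸 := m) (A := id) (measurable_id'' hm) hW hρ
  rw [MeasurableSpace.comap_id] at this
  exact this hi

end Basic

end IsCondLaw

/-! ### Bayes' formula for a noisy linear observation -/

/-- The law `𝒩(q (l - h), q)` has density `expQuad q · h l` with respect to `𝒩(0, q)`. -/
lemma gaussianReal_withDensity_expQuad_left (q : ℝ≥0) (h l : ℝ) :
    (gaussianReal 0 q).withDensity (fun z => expQuad q z h l) = gaussianReal (q * (l - h)) q := by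
  -- As a function of `z` the weight is a constant times an exponential of a linear form, hence
  -- quadratic coefficient `0` and slope `l - h`.
  have h1 := gaussianReal_withDensity_expQuad 0 q le_rfl (l - h) 0
  simp only [zero_mul, add_zero, sub_zero, div_one, zero_add, Real.toNNReal_coe] at h1
  have h2 : (fun z => expQuad q z h l)
      = ENNReal.ofReal (Real.exp (-(q * (l - h) ^ 2 / 2))) • expQuad 0 (l - h) 0 := by
    ext z
    simp only [expQuad, Pi.smul_apply, smul_eq_mul]
    rw [← ENNReal.ofReal_mul (Real.exp_pos _).le, ← Real.exp_add]
    congr 2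
    ring
  rw [h2, withDensity_smul _ (by fun_prop), h1, smul_smul,
    ← ENNReal.ofReal_mul (Real.exp_pos _).le]
  have : Real.exp (-(q * (l - h) ^ 2 / 2)) * expQuadMass 0 (l - h) 0 0 q = 1 := by
    simp only [expQuadMass, zero_mul, add_zero, Real.one_rpow, one_mul, ← Real.exp_add]
    simp
  rw [this]
  simp

lemma gaussianReal_map_sqrt_add (q : ℝ≥0) (u : ℝ) :
    (gaussianReal 0 1).map (fun e => u + √q * e) = gaussianReal u q := by
  have h1 : (gaussianReal 0 1).map (fun e => √q * e) = gaussianReal 0 q := by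
    rw [gaussianReal_map_const_mul]
    congr 1
    · simp
    · ext; simp
  have h2 : (fun e : ℝ => u + √q * e) = (fun x => u + x) ∘ (fun e => √q * e) := rfl
  rw [h2, ← Measure.map_map (by fun_prop) (by fun_prop), h1, gaussianReal_map_const_add, zero_add]

namespace IsCondLaw

section Update

variable {Ω E : Type*} {m mΩ : MeasurableSpace Ω} {P : Measure Ω} [IsProbabilityMeasure P]
  [NormedAddCommGroup E] [NormedSpace ℝ E] [CompleteSpace E]
  [mE : MeasurableSpace E] [BorelSpace E] [SecondCountableTopology E]
  {V : Ω → E} {κ : Ω → Measure E}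

/-- Conditioning further on a linear functional of a conditionally Gaussian vector. -/
lemma condOn (h : IsCondLaw m P V κ) (hG : ∀ᵐ ω ∂P, IsGaussian (κ ω)) (L : StrongDual ℝ E) :
    IsCondLaw (m ⊔ MeasurableSpace.comap (fun ω => L (V ω)) inferInstance) P V
      (fun ω => condOn (κ ω) L (L (V ω))) := by
  have hκ' := @measurable_condOn Ω E m _ _ _ mE _ _ κ h.measurable h.mass_le L
  have hκ1 : ∀ p : Ω × ℝ, LEGFilter.condOn (κ p.1) L p.2 Set.univ ≤ 1 := fun p => by
    rw [condOn_univ]; exact h.mass_le _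
  refine of_sup_comap (fun ω => L (V ω)) (κ := fun p => LEGFilter.condOn (κ p.1) L p.2) hκ' hκ1
    fun Φ hΦ => ?_
  have hΨ : Measurable[m.prod mE] fun p : Ω × E => Φ ((p.1, L p.2), p.2) := by
    let _ := m
    exact hΦ.comp (by fun_prop : Measurable fun p : Ω × E => ((p.1, L p.2), p.2))
  have hD : Measurable[m.prod mE] fun p : Ω × E =>
      ∫⁻ v', Φ ((p.1, L p.2), v') ∂LEGFilter.condOn (κ p.1) L (L p.2) := by
    have h1 := @measurable_lintegral_family _ E (m.prod inferInstance) mE _ hκ' hκ1 Φ hΦ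
    let _ := m
    exact h1.comp (by fun_prop : Measurable fun p : Ω × E => (p.1, L p.2))
  -- Once both sides are disintegrated along `κ`, the claim is the Gaussian disintegration along `L`
  -- for almost every fixed `ω`.
  rw [h.lintegral_eq _ hΨ, h.lintegral_eq _ hD]
  refine lintegral_congr_ae ?_
  filter_upwards [hG] with ω hω
  refine lintegral_eq_lintegral_lintegral_condOn (κ ω) L (g := fun l v => Φ ((ω, l), v)) ?_
  let _ := m
  exact hΦ.comp (by fun_prop : Measurable fun p : ℝ × E => ((ω, p.1), p.2))

/-- Conditioning further on a noisy observation of a linear functional of a conditionally Gaussian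
vector. -/
lemma bayes (h : IsCondLaw m P V κ) (hG : ∀ᵐ ω ∂P, IsGaussian (κ ω))
    {𝒜 : MeasurableSpace Ω} (h𝒜 : m ≤ 𝒜) (hV : Measurable[𝒜] V) {ε : Ω → ℝ}
    (hε : IsCondLaw 𝒜 P ε (fun _ => gaussianReal 0 1)) (L : StrongDual ℝ E) {q : ℝ} (hq : 0 ≤ q)
    {f : Ω → ℝ} (hf : Measurable[m] f) {Z : Ω → ℝ}
    (hZ : ∀ ω, Z ω = q * (L (V ω) - f ω) + √q * ε ω) :
    IsCondLaw (m ⊔ MeasurableSpace.comap Z inferInstance) P V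
      (fun ω => weighted (κ ω) fun v => expQuad q (Z ω) (f ω) (L v)) := by
  lift q to ℝ≥0 using hq
  set w : Ω × ℝ → E → ℝ≥0∞ := fun p v => expQuad q p.2 (f p.1) (L v) with hw
  have hwm : Measurable[(m.prod inferInstance).prod mE] (Function.uncurry w) := by
    let _ := m
    have : Measurable f := hf
    simp only [hw, Function.uncurry_def]
    have h1 : Measurable fun p : (Ω × ℝ) × E => f p.1.1 :=
      this.comp (measurable_fst.comp measurable_fst)
    fun_prop
  have hκ' : Measurable[m.prod inferInstance] fun p : Ω × ℝ => weighted (κ p.1) (w p) := by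
    let _ := m
    have : Measurable κ := h.measurable
    exact measurable_weighted (κ := fun p : Ω × ℝ => κ p.1) (this.comp measurable_fst)
      (fun p => h.mass_le _) hwm
  have hκ1 : ∀ p : Ω × ℝ, weighted (κ p.1) (w p) Set.univ ≤ 1 := fun p => weighted_univ_le _ _
  -- Given `m`, the pair `(Z, V)` has density `w` with respect to `𝒩(0, q) ⊗ κ`. The noise is
  -- integrated first, given `𝒜`, to which `V` belongs; then `V` is integrated given `m`. The case
  -- `q = 0` is included.
  have key : ∀ Φ : (Ω × ℝ) × E → ℝ≥0∞, Measurable[(m.prod inferInstance).prod mE] Φ →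
      ∫⁻ ω, Φ ((ω, Z ω), V ω) ∂P
        = ∫⁻ ω, ∫⁻ z, ∫⁻ v, w (ω, z) v * Φ ((ω, z), v) ∂κ ω ∂(gaussianReal 0 q) ∂P := by
    intro Φ hΦ
    have hΨ : Measurable[𝒜.prod inferInstance] fun p : Ω × ℝ =>
        Φ ((p.1, q * (L (V p.1) - f p.1) + √q * p.2), V p.1) := by
      have hΦ' : Measurable[(𝒜.prod inferInstance).prod mE] Φ :=
        hΦ.mono (sup_le_sup (MeasurableSpace.comap_mono (sup_le_sup
          (MeasurableSpace.comap_mono h𝒜) le_rfl)) le_rfl) le_rfl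
      let _ := 𝒜
      have h1 : Measurable f := hf.mono h𝒜 le_rfl
      have h2 : Measurable V := hV
      exact hΦ'.comp (by fun_prop :
        Measurable fun p : Ω × ℝ => ((p.1, q * (L (V p.1) - f p.1) + √q * p.2), V p.1))
    have hH : Measurable[m.prod mE] fun p : Ω × E =>
        ∫⁻ e, Φ ((p.1, q * (L p.2 - f p.1) + √q * e), p.2) ∂(gaussianReal 0 1) := by
      let _ := m
      have h1 : Measurable f := hf
      exact (hΦ.comp (by fun_prop : Measurable fun p : (Ω × E) × ℝ =>
        ((p.1.1, q * (L p.1.2 - f p.1.1) + √q * p.2), p.1.2))).lintegral_prod_right'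
    have e1 := hε.lintegral_eq _ hΨ
    have e2 := h.lintegral_eq _ hH
    simp only at e1 e2
    simp only [hZ]
    rw [e1, e2]
    refine lintegral_congr_ae ?_
    filter_upwards [hG] with ω hω
    have hΦω : Measurable fun p : ℝ × E => Φ ((ω, p.1), p.2) := by
      let _ := m
      exact hΦ.comp (by fun_prop : Measurable fun p : ℝ × E => ((ω, p.1), p.2))
    have hwω : Measurable fun p : ℝ × E => w (ω, p.1) p.2 := by
      simp only [hw]; fun_prop
    have hswap := lintegral_lintegral_swap (μ := gaussianReal 0 q) (ν := κ ω)
      (f := fun z v => w (ω, z) v * Φ ((ω, z), v)) (hwω.mul hΦω).aemeasurable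
    rw [hswap]
    refine lintegral_congr fun v => ?_
    have h3 : Measurable fun z => Φ ((ω, z), v) := hΦω.comp measurable_prodMk_right
    have h4 : Measurable fun z => w (ω, z) v := hwω.comp measurable_prodMk_right
    calc _ = ∫⁻ z, Φ ((ω, z), v) ∂(gaussianReal (q * (L v - f ω)) q) := by
          rw [← gaussianReal_map_sqrt_add q (q * (L v - f ω)), lintegral_map h3 (by fun_prop)]
      _ = _ := by
          rw [← gaussianReal_withDensity_expQuad_left,
            lintegral_withDensity_eq_lintegral_mul _ h4 h3]
          rfl
  refine of_sup_comap Z (κ := fun p => weighted (κ p.1) (w p)) hκ' hκ1 fun Φ hΦ => ?_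
  have hD : Measurable[(m.prod inferInstance).prod mE] fun p : (Ω × ℝ) × E =>
      ∫⁻ v, Φ (p.1, v) ∂weighted (κ p.1.1) (w p.1) := by
    have h1 := @measurable_lintegral_family _ E (m.prod inferInstance) mE _ hκ' hκ1 Φ hΦ
    let _ := m
    exact h1.comp measurable_fst
  -- `key` is applied to `Φ` and to its average over the candidate law. The two integrands agree
  -- because total weight times weighted average is the unnormalized integral.
  rw [key Φ hΦ, key _ hD]
  refine lintegral_congr_ae ?_
  filter_upwards [hG] with ω hω
  refine lintegral_congr fun z => ?_
  have h1 : Measurable fun v => Φ ((ω, z), v) := by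
    let _ := m
    exact hΦ.comp measurable_prodMk_left
  have h2 : Measurable (w (ω, z)) := by simp only [hw]; fun_prop
  rw [lintegral_mul_const _ h2, lintegral_mul_eq_mul_lintegral_weighted h2
    (lintegral_expQuad_dual_ne_zero (κ ω) L q.2 _ _)
    (lintegral_expQuad_dual_ne_top (κ ω) L q.2 _ _) h1]

end Update

end IsCondLaw

/-! ### The observation σ-algebras and the auxiliary noise -/

section Sigma

variable {Ω : Type*} (U : ℕ → Ω → ℝ)

lemma pastSigma_zero : pastSigma U 0 = ⊥ := by simp [pastSigma]

lemma pastSigma_succ (n : ℕ) :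
    pastSigma U (n + 1) = pastSigma U n ⊔ MeasurableSpace.comap (U (n + 1)) inferInstance := by
  rw [pastSigma, ← Finset.insert_Icc_right_eq_Icc_add_one (by omega), Finset.iSup_insert, sup_comm]
  rfl

lemma pastSigma_mono {s t : ℕ} (h : s ≤ t) : pastSigma U s ≤ pastSigma U t :=
  biSup_mono fun _ hs => Finset.mem_Icc.2 ⟨(Finset.mem_Icc.1 hs).1, (Finset.mem_Icc.1 hs).2.trans h⟩

variable {U}

lemma measurable_pastSigma {s t : ℕ} (hs : 1 ≤ s) (hst : s ≤ t) : Measurable[pastSigma U t] (U s) :=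
  (comap_measurable (U s)).mono (le_iSup₂_of_le s (Finset.mem_Icc.2 ⟨hs, hst⟩) le_rfl) le_rfl

lemma pastSigma_le {m : MeasurableSpace Ω} {t : ℕ}
    (h : ∀ s, 1 ≤ s → s ≤ t → Measurable[m] (U s)) : pastSigma U t ≤ m :=
  iSup₂_le fun s hs => (h s (Finset.mem_Icc.1 hs).1 (Finset.mem_Icc.1 hs).2).comap_le

lemma pastSigma_eq_comap (t : ℕ) : pastSigma U t
    = MeasurableSpace.comap (fun ω (s : Finset.Icc 1 t) => U s ω) inferInstance := by
  simp only [MeasurableSpace.pi, MeasurableSpace.comap_iSup, MeasurableSpace.comap_comp, pastSigma,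
    iSup_subtype]
  rfl

end Sigma

/-- The σ-algebra generated by the whole process `((X_t, Y_t))_{t ≥ 1}`. -/
abbrev processSigma {Ω : Type*} (X Y : ℕ → Ω → ℝ) : MeasurableSpace Ω :=
  MeasurableSpace.comap (fun ω (t : ℕ) => (X (t + 1) ω, Y (t + 1) ω)) inferInstance

section PairProcess

variable {Ω : Type*} {X Y : ℕ → Ω → ℝ}

lemma measurable_processSigma_pair {t : ℕ} (ht : 1 ≤ t) :
    Measurable[processSigma X Y] fun ω => (X t ω, Y t ω) := by
  obtain ⟨s, rfl⟩ := Nat.exists_eq_add_of_le' ht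
  let _ := processSigma X Y
  have h : Measurable fun ω (t : ℕ) => (X (t + 1) ω, Y (t + 1) ω) := comap_measurable _
  exact (measurable_pi_apply s).comp h

lemma measurable_processSigma_left {t : ℕ} (ht : 1 ≤ t) : Measurable[processSigma X Y] (X t) := by
  let _ := processSigma X Y
  exact measurable_fst.comp (measurable_processSigma_pair ht)

lemma measurable_processSigma_right {t : ℕ} (ht : 1 ≤ t) : Measurable[processSigma X Y] (Y t) := by
  let _ := processSigma X Y
  exact measurable_snd.comp (measurable_processSigma_pair ht)

end PairProcess

/-- Both hypotheses together say that the law of `(A, B, C)` is a triple product, and product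
measures are associative. -/
lemma indepFun_prodMk_of_indepFun {Ω α β γ : Type*} {mΩ : MeasurableSpace Ω} [MeasurableSpace α]
    [MeasurableSpace β] [MeasurableSpace γ] {P : Measure Ω} [IsProbabilityMeasure P] {A : Ω → α}
    {B : Ω → β} {C : Ω → γ} (hA : Measurable A) (hB : Measurable B) (hC : Measurable C)
    (h : IndepFun A (fun ω => (B ω, C ω)) P) (h' : IndepFun B C P) :
    IndepFun (fun ω => (A ω, B ω)) C P := by
  have hAB : IndepFun A B P := h.comp measurable_id measurable_fst
  have := Measure.isProbabilityMeasure_map (μ := P) hA.aemeasurable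
  have := Measure.isProbabilityMeasure_map (μ := P) hB.aemeasurable
  have := Measure.isProbabilityMeasure_map (μ := P) hC.aemeasurable
  rw [indepFun_iff_map_prod_eq_prod_map_map (by fun_prop) (by fun_prop)] at h h' hAB ⊢
  refine MeasurableEquiv.prodAssoc.map_measurableEquiv_injective ?_
  rw [hAB, Measure.prodAssoc_prod, ← h', ← h, Measure.map_map (by fun_prop) (by fun_prop)]
  rfl

section Noise

variable {Ω : Type*} {m mΩ : MeasurableSpace Ω} {P : Measure Ω} [IsProbabilityMeasure P]
  {X Y ε h : ℕ → Ω → ℝ} {Q : ℕ → ℝ}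

lemma processSigma_le (hX : ∀ t, 1 ≤ t → Measurable (X t)) (hY : ∀ t, 1 ≤ t → Measurable (Y t)) :
    processSigma X Y ≤ mΩ :=
  (measurable_pi_lambda _ fun t =>
    (hX (t + 1) (by omega)).prodMk (hY (t + 1) (by omega))).comap_le

lemma isCondLaw_noise (hX : ∀ t, 1 ≤ t → Measurable (X t)) (hY : ∀ t, 1 ≤ t → Measurable (Y t))
    (hε : IsAuxiliaryNoise P X Y ε) (k : ℕ) :
    IsCondLaw (processSigma X Y ⊔ pastSigma ε k) P (ε (k + 1)) (fun _ => gaussianReal 0 1) := by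
  have hε1 : ∀ i : ℕ, Measurable (ε (i + 1)) := fun i => hε.measurable _ (by omega)
  have hXY : Measurable fun ω (t : ℕ) => (X (t + 1) ω, Y (t + 1) ω) :=
    measurable_pi_lambda _ fun t => (hX (t + 1) (by omega)).prodMk (hY (t + 1) (by omega))
  refine IsCondLaw.of_indep (sup_le (processSigma_le hX hY)
    (pastSigma_le fun s hs _ => hε.measurable s hs)) (hε1 k) (hε.law _ (by omega)) ?_
  have h1 : IndepFun (fun ω (i : Finset.range k) => ε (i + 1) ω) (ε (k + 1)) P :=
    (hε.iIndep.indepFun_finset (Finset.range k) {k} (by simp) hε1).comp measurable_id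
      (measurable_pi_apply (⟨k, by simp⟩ : ({k} : Finset ℕ)))
  have h2 : IndepFun (fun ω (t : ℕ) => (X (t + 1) ω, Y (t + 1) ω))
      (fun ω => ((fun (i : Finset.range k) => ε (i + 1) ω), ε (k + 1) ω)) P :=
    hε.indep.comp (ψ := fun e : ℕ → ℝ => ((fun (i : Finset.range k) => e i), e k)) measurable_id
      (by fun_prop)
  have h3 := indepFun_prodMk_of_indepFun hXY (by fun_prop) (hε1 k) h2 h1
  rw [IndepFun_iff_Indep] at h3
  refine indep_of_indep_of_le_left h3 (sup_le ?_ (pastSigma_le fun s hs hsk => ?_))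
  · rw [processSigma, ← measurable_iff_comap_le]
    exact measurable_fst.comp (comap_measurable _)
  · obtain ⟨i, rfl⟩ := Nat.exists_eq_add_of_le' hs
    have h4 : Measurable fun p : (ℕ → ℝ × ℝ) × (Finset.range k → ℝ) =>
        p.2 ⟨i, by simp; omega⟩ := by fun_prop
    exact h4.comp (comap_measurable _)

variable {E : Type*} [NormedAddCommGroup E] [NormedSpace ℝ E] [CompleteSpace E]
  [mE : MeasurableSpace E] [BorelSpace E] [SecondCountableTopology E]
  {V : Ω → E} {κ : Ω → Measure E}

lemma measurable_uncurry_prodWeight {α : Type*} [MeasurableSpace α] (ℓ : ℕ → StrongDual ℝ E)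
    {z f : ℕ → α → ℝ} {n : ℕ} (hz : ∀ s, 1 ≤ s → s ≤ n → Measurable (z s))
    (hf : ∀ s, 1 ≤ s → s ≤ n → Measurable (f s)) :
    Measurable (Function.uncurry fun (a : α) (v : E) =>
      prodWeight Q (fun s => z s a) (fun s => f s a) ℓ n v) := by
  simp only [Function.uncurry_def, prodWeight]
  refine Finset.measurable_prod _ fun s hs => ?_
  obtain ⟨h1, h2⟩ := Finset.mem_Icc.1 hs
  have : Measurable fun p : α × E => z s p.1 := (hz s h1 h2).comp measurable_fst
  have : Measurable fun p : α × E => f s p.1 := (hf s h1 h2).comp measurable_fst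
  have : Measurable fun p : α × E => ℓ s p.2 := by fun_prop
  fun_prop

/-- The conditional law of `V` given the auxiliary observations in addition to `m`. -/
lemma IsCondLaw.sup_pastSigma_auxObs (hκ : IsCondLaw m P V κ) (hG : ∀ᵐ ω ∂P, IsGaussian (κ ω))
    (hX : ∀ t, 1 ≤ t → Measurable (X t)) (hY : ∀ t, 1 ≤ t → Measurable (Y t))
    (hε : IsAuxiliaryNoise P X Y ε) (hQ : ∀ t, 1 ≤ t → 0 ≤ Q t) (hm : m ≤ processSigma X Y)
    (hV : Measurable[processSigma X Y] V) {n : ℕ}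
    (hh : ∀ s, 1 ≤ s → s ≤ n → Measurable[m] (h s)) (ℓ : ℕ → StrongDual ℝ E)
    (hℓ : ∀ s, 1 ≤ s → s ≤ n → ∀ ω, X s ω = ℓ s (V ω)) :
    IsCondLaw (m ⊔ pastSigma (auxObs X ε h Q) n) P V (fun ω => weighted (κ ω)
      (prodWeight Q (fun s => auxObs X ε h Q s ω) (fun s => h s ω) ℓ n)) := by
  induction n with
  | zero =>
    simp only [prodWeight_zero, pastSigma_zero, sup_bot_eq]
    refine hκ.congr ?_ ?_ fun ω => weighted_univ_le _ _
    · filter_upwards [hG] with ω hω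
      rw [weighted_one]
    · let _ := m
      have : Measurable κ := hκ.measurable
      exact measurable_weighted (w := fun _ _ => 1) this hκ.mass_le measurable_const
  | succ n ih =>
    have ih := ih (fun s h1 h2 => hh s h1 (by omega)) fun s h1 h2 => hℓ s h1 (by omega)
    have hZm : ∀ s, 1 ≤ s → s ≤ n + 1 →
        Measurable[processSigma X Y ⊔ pastSigma ε s] (auxObs X ε h Q s) := fun s h1 h2 => by
      have e1 : Measurable[processSigma X Y ⊔ pastSigma ε s] (X s) :=
        (measurable_processSigma_left h1).mono le_sup_left le_rfl
      have e2 : Measurable[processSigma X Y ⊔ pastSigma ε s] (h s) :=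
        (hh s h1 h2).mono (hm.trans le_sup_left) le_rfl
      have e3 : Measurable[processSigma X Y ⊔ pastSigma ε s] (ε s) :=
        (measurable_pastSigma h1 le_rfl).mono le_sup_right le_rfl
      exact ((e1.sub e2).const_mul _).add (e3.const_mul _)
    -- The first `n` auxiliary observations involve only the process and the first `n` noises, so
    -- the next noise is still standard Gaussian given all of them.
    have h𝒜 : m ⊔ pastSigma (auxObs X ε h Q) n ≤ processSigma X Y ⊔ pastSigma ε n :=
      sup_le (hm.trans le_sup_left) (pastSigma_le fun s h1 h2 => (hZm s h1 (by omega)).mono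
        (sup_le_sup le_rfl (pastSigma_mono _ h2)) le_rfl)
    have hG' : ∀ᵐ ω ∂P, IsGaussian (weighted (κ ω)
        (prodWeight Q (fun s => auxObs X ε h Q s ω) (fun s => h s ω) ℓ n)) := by
      filter_upwards [hG] with ω hω using (weighted_prodWeight_spec hQ _ _ ℓ (κ ω) n).1
    have key := ih.bayes hG' h𝒜 (hV.mono le_sup_left le_rfl) (isCondLaw_noise hX hY hε n)
      (ℓ (n + 1)) (hQ (n + 1) (by omega)) ((hh (n + 1) (by omega) le_rfl).mono le_sup_left le_rfl)
      (Z := auxObs X ε h Q (n + 1))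
      (fun ω => by rw [auxObs, hℓ (n + 1) (by omega) le_rfl ω])
    rw [sup_assoc, ← pastSigma_succ] at key
    refine key.congr ?_ ?_ fun ω => weighted_univ_le _ _
    · filter_upwards [hG] with ω hω
      exact (weighted_prodWeight_succ hQ _ _ ℓ (κ ω) n).symm
    · have hκ' : Measurable[m ⊔ pastSigma (auxObs X ε h Q) (n + 1)] κ :=
        hκ.measurable.mono le_sup_left le_rfl
      have hz : ∀ s, 1 ≤ s → s ≤ n + 1 →
          Measurable[m ⊔ pastSigma (auxObs X ε h Q) (n + 1)] (auxObs X ε h Q s) :=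
        fun s h1 h2 => (measurable_pastSigma h1 h2).mono le_sup_right le_rfl
      have hf : ∀ s, 1 ≤ s → s ≤ n + 1 →
          Measurable[m ⊔ pastSigma (auxObs X ε h Q) (n + 1)] (h s) :=
        fun s h1 h2 => (hh s h1 h2).mono le_sup_left le_rfl
      let _ := m ⊔ pastSigma (auxObs X ε h Q) (n + 1)
      exact measurable_weighted hκ' hκ.mass_le (measurable_uncurry_prodWeight ℓ hz hf)

end Noise

/-! ### Conditional moments under a conditionally Gaussian law -/

namespace IsCondLaw

section Moments

variable {Ω E : Type*} {m mΩ : MeasurableSpace Ω} {P : Measure Ω} [IsProbabilityMeasure P]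
  [NormedAddCommGroup E] [NormedSpace ℝ E] [CompleteSpace E]
  [mE : MeasurableSpace E] [BorelSpace E] [SecondCountableTopology E]
  {V : Ω → E} {ρ : Ω → Measure E}

lemma condMean_dual (h : IsCondLaw m P V ρ) (hm : m ≤ mΩ) (hG : ∀ᵐ ω ∂P, IsGaussian (ρ ω))
    {U : Ω → ℝ} {L : StrongDual ℝ E} (hU : ∀ ω, U ω = L (V ω)) :
    CondIntegrable m P U ∧ condMean m P U =ᵐ[P] fun ω => (ρ ω)[L] := by
  obtain rfl : U = fun ω => L (V ω) := funext hU
  refine h.condIntegrable_and_condMean_ae_eq hm (F := fun p => L p.2) ?_ ?_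
  · let _ := m
    exact L.measurable.comp measurable_snd
  · filter_upwards [hG] with ω hω using IsGaussian.integrable_dual (ρ ω) L

/-- Meant for `ξ`: the coefficients are known given `m`, so the variable is affine under each
Gaussian law `ρ ω` and integrable there, even if it is not integrable under `P`. -/
lemma condMean_sum_smul (h : IsCondLaw m P V ρ) (hm : m ≤ mΩ)
    (hG : ∀ᵐ ω ∂P, IsGaussian (ρ ω)) {z : ℕ → Ω → ℝ} {c : Ω → ℝ} {ℓ : ℕ → StrongDual ℝ E} {n : ℕ}
    (hz : ∀ s, 1 ≤ s → s ≤ n → Measurable[m] (z s)) (hc : Measurable[m] c) {U : Ω → ℝ}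
    (hU : ∀ ω, U ω = (∑ s ∈ Finset.Icc 1 n, z s ω * ℓ s (V ω)) - c ω) :
    CondIntegrable m P U := by
  obtain rfl : U = fun ω => (∑ s ∈ Finset.Icc 1 n, z s ω * ℓ s (V ω)) - c ω := funext hU
  refine (h.condIntegrable_and_condMean_ae_eq hm
    (F := fun p => (∑ s ∈ Finset.Icc 1 n, z s p.1 * ℓ s p.2) - c p.1) ?_ ?_).1
  · let _ := m
    refine (Finset.measurable_sum _ fun s hs => ?_).sub (hc.comp measurable_fst)
    exact ((hz s (Finset.mem_Icc.1 hs).1 (Finset.mem_Icc.1 hs).2).comp measurable_fst).mul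
      ((ℓ s).measurable.comp measurable_snd)
  · filter_upwards [hG] with ω hω
    refine (integrable_finsetSum _ fun s hs => ?_).sub (integrable_const _)
    exact (IsGaussian.integrable_dual (ρ ω) (ℓ s)).const_mul _

/-- Since `U` is conditionally centred, the `m`-measurable shift `c` of the other factor does not
contribute. Hence `c` may be any conditional centring, even one computed for a smaller σ-algebra. -/
lemma condMean_mul (h : IsCondLaw m P V ρ) (hm : m ≤ mΩ) (hG : ∀ᵐ ω ∂P, IsGaussian (ρ ω))
    {U : Ω → ℝ} {L : StrongDual ℝ E} (hU : ∀ ω, U ω = L (V ω)) {z : ℕ → Ω → ℝ} {c : Ω → ℝ}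
    {ℓ : ℕ → StrongDual ℝ E} {n : ℕ}
    (hz : ∀ s, 1 ≤ s → s ≤ n → Measurable[m] (z s)) (hc : Measurable[m] c) {W : Ω → ℝ}
    (hW : ∀ ω, W ω = (∑ s ∈ Finset.Icc 1 n, z s ω * ℓ s (V ω)) - c ω) :
    CondIntegrable m P (fun ω => (U ω - condMean m P U ω) * W ω)
      ∧ condMean m P (fun ω => (U ω - condMean m P U ω) * W ω) =ᵐ[P] fun ω =>
        covarianceBilinDual (ρ ω) L (∑ s ∈ Finset.Icc 1 n, z s ω • ℓ s) := by
  obtain rfl : W = fun ω => (∑ s ∈ Finset.Icc 1 n, z s ω * ℓ s (V ω)) - c ω := funext hW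
  have hmean := (h.condMean_dual hm hG hU).2
  set cm := condMean m P U with hcm
  have hcmm : Measurable[m] cm := measurable_condMean U
  have hfun : (fun ω => (U ω - cm ω) * ((∑ s ∈ Finset.Icc 1 n, z s ω * ℓ s (V ω)) - c ω))
      = fun ω => (fun p : Ω × E => (L p.2 - cm p.1)
        * ((∑ s ∈ Finset.Icc 1 n, z s p.1 * ℓ s p.2) - c p.1)) (ω, V ω) := by
    ext ω; simp [hU]
  rw [hfun]
  have hsum : ∀ ω v, ∑ s ∈ Finset.Icc 1 n, z s ω * ℓ s v
      = (∑ s ∈ Finset.Icc 1 n, z s ω • ℓ s : StrongDual ℝ E) v := fun ω v => by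
    simp
  have hF : Measurable[m.prod mE] fun p : Ω × E => (L p.2 - cm p.1)
      * ((∑ s ∈ Finset.Icc 1 n, z s p.1 * ℓ s p.2) - c p.1) := by
    let _ := m
    refine ((L.measurable.comp measurable_snd).sub (hcmm.comp measurable_fst)).mul
      ((Finset.measurable_sum _ fun s hs => ?_).sub (hc.comp measurable_fst))
    exact ((hz s (Finset.mem_Icc.1 hs).1 (Finset.mem_Icc.1 hs).2).comp measurable_fst).mul
      ((ℓ s).measurable.comp measurable_snd)
  have hi : ∀ ω, IsGaussian (ρ ω) → ∀ (M N : StrongDual ℝ E) (a b : ℝ),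
      Integrable (fun v => (M v - a) * (N v - b)) (ρ ω) := fun ω hω M N a b =>
    MemLp.integrable_mul (p := 2) (q := 2) ((memLp_dual_two (ρ ω) M).sub (memLp_const _))
      ((memLp_dual_two (ρ ω) N).sub (memLp_const _))
  have key := h.condIntegrable_and_condMean_ae_eq hm hF (by
    filter_upwards [hG] with ω hω
    simp only [hsum]
    exact hi ω hω _ _ _ _)
  refine ⟨key.1, key.2.trans ?_⟩
  filter_upwards [hG, hmean] with ω hω hmω
  simp only [hsum, hmω]
  set M := (∑ s ∈ Finset.Icc 1 n, z s ω • ℓ s : StrongDual ℝ E)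
  rw [covarianceBilinDual_apply IsGaussian.memLp_two_id]
  have e : ∀ v, (L v - (ρ ω)[L]) * (M v - c ω) = (L v - (ρ ω)[L]) * (M v - (ρ ω)[M])
      + ((ρ ω)[M] - c ω) * (L v - (ρ ω)[L]) := fun v => by ring
  have i1 : Integrable (fun v => L v - (ρ ω)[L]) (ρ ω) :=
    (IsGaussian.integrable_dual (ρ ω) L).sub (integrable_const _)
  simp only [e]
  rw [integral_add (hi ω hω _ _ _ _) (i1.const_mul _), integral_const_mul,
    integral_sub (IsGaussian.integrable_dual (ρ ω) L) (integrable_const _)]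
  simp

lemma condMean_sq (h : IsCondLaw m P V ρ) (hm : m ≤ mΩ) (hG : ∀ᵐ ω ∂P, IsGaussian (ρ ω))
    {U : Ω → ℝ} {L : StrongDual ℝ E} (hU : ∀ ω, U ω = L (V ω)) :
    CondIntegrable m P (fun ω => (U ω - condMean m P U ω) ^ 2)
      ∧ condMean m P (fun ω => (U ω - condMean m P U ω) ^ 2) =ᵐ[P] fun ω =>
        covarianceBilinDual (ρ ω) L L := by
  have := h.condMean_mul hm hG hU (z := fun _ _ => 1) (c := condMean m P U) (ℓ := fun _ => L)
    (n := 1) (fun _ _ _ => measurable_const) (measurable_condMean U)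
    (W := fun ω => U ω - condMean m P U ω) (fun ω => by simp [hU])
  simpa [← sq] using this

end Moments

/-- The conditional expectation of a variable given `m` and a functional of `V`, when its weighted
conditional law has a density with respect to the conditional law of that functional. -/
lemma condLExp_sup_comap {Ω E : Type*} {m mΩ : MeasurableSpace Ω} {P : Measure Ω}
    [IsProbabilityMeasure P] [mE : MeasurableSpace E] {V : Ω → E} {κ : Ω → Measure E}
    (h : IsCondLaw m P V κ) (hm : m ≤ mΩ) {η : E → ℝ} (hη : Measurable η)
    (hηV : Measurable fun ω => η (V ω)) {w : Ω × E → ℝ≥0∞} (hw : Measurable[m.prod mE] w)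
    {R : Ω × ℝ → ℝ≥0∞} (hR : Measurable[m.prod inferInstance] R)
    (hwR : ∀ᵐ ω ∂P, ∀ Φ : ℝ → ℝ≥0∞, Measurable Φ →
      ∫⁻ v, Φ (η v) * w (ω, v) ∂κ ω = ∫⁻ v, Φ (η v) * R (ω, η v) ∂κ ω) :
    condLExp (m ⊔ MeasurableSpace.comap (fun ω => η (V ω)) inferInstance) P
      (fun ω => w (ω, V ω)) =ᵐ[P] fun ω => R (ω, η (V ω)) := by
  have e : m ⊔ MeasurableSpace.comap (fun ω => η (V ω)) inferInstance
      = MeasurableSpace.comap (fun ω => (ω, η (V ω))) (m.prod inferInstance) := by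
    simp only [MeasurableSpace.prod, MeasurableSpace.comap_sup, MeasurableSpace.comap_comp]
    change _ = MeasurableSpace.comap id m ⊔ MeasurableSpace.comap (fun ω => η (V ω)) _
    rw [MeasurableSpace.comap_id]
  have hle : m ⊔ MeasurableSpace.comap (fun ω => η (V ω)) inferInstance ≤ mΩ :=
    sup_le hm hηV.comap_le
  rw [e] at hle ⊢
  refine (ae_eq_condLExp hle P _ ?_ fun s hs => ?_).symm
  · exact hR.comp (comap_measurable (m := m.prod inferInstance) fun ω => (ω, η (V ω)))
  · obtain ⟨S, hS, rfl⟩ := hs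
    have hSη : Measurable[m.prod mE] fun p : Ω × E =>
        S.indicator (1 : Ω × ℝ → ℝ≥0∞) (p.1, η p.2) := by
      let _ := m
      exact (measurable_one.indicator hS).comp
        (measurable_fst.prodMk (hη.comp measurable_snd))
    have hRη : Measurable[m.prod mE] fun p : Ω × E => R (p.1, η p.2) := by
      let _ := m
      exact hR.comp (measurable_fst.prodMk (hη.comp measurable_snd))
    have e1 := h.lintegral_eq _ (Measurable.mul hSη hw)
    have e2 := h.lintegral_eq _ (Measurable.mul hSη hRη)
    have e3 : ∀ f : Ω → ℝ≥0∞, ∫⁻ ω in (fun ω => (ω, η (V ω))) ⁻¹' S, f ω ∂P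
        = ∫⁻ ω, S.indicator (1 : Ω × ℝ → ℝ≥0∞) (ω, η (V ω)) * f ω ∂P := by
      intro f
      rw [← lintegral_indicator (hle _ ⟨S, hS, rfl⟩)]
      refine lintegral_congr fun ω => ?_
      by_cases hω : (ω, η (V ω)) ∈ S <;> simp [Set.indicator, hω]
    rw [e3, e3]
    simp only [Pi.mul_apply] at e1 e2
    rw [e1, e2]
    refine lintegral_congr_ae ?_
    filter_upwards [hwR] with ω hω
    -- For fixed `ω` the event is a function of the value of `η` alone, so its section is an
    -- admissible test function.
    refine (hω (fun y => S.indicator (1 : Ω × ℝ → ℝ≥0∞) (ω, y)) ?_).symm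
    let _ := m
    exact (measurable_one.indicator hS).comp measurable_prodMk_left

end IsCondLaw

/-! ### Ratios of Gaussian densities -/

/-- The ratio of the densities of `𝒩(m₂, v₂)` and `𝒩(m₁, v₁)`. -/
noncomputable def gaussianRatio (m₁ v₁ m₂ v₂ y : ℝ) : ℝ :=
  (v₁ / v₂) ^ (1 / 2 : ℝ) * Real.exp (1 / (2 * v₁) * (y - m₁) ^ 2 - 1 / (2 * v₂) * (y - m₂) ^ 2)

lemma gaussianRatio_nonneg {v₁ v₂ : ℝ} (h₁ : 0 ≤ v₁) (h₂ : 0 ≤ v₂) (m₁ m₂ y : ℝ) :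
    0 ≤ gaussianRatio m₁ v₁ m₂ v₂ y := by
  unfold gaussianRatio
  positivity

lemma Measurable.gaussianRatio {α : Type*} {_ : MeasurableSpace α} {m₁ v₁ m₂ v₂ y : α → ℝ}
    (h₁ : Measurable m₁) (h₂ : Measurable v₁) (h₃ : Measurable m₂) (h₄ : Measurable v₂)
    (h₅ : Measurable y) : Measurable fun a => gaussianRatio (m₁ a) (v₁ a) (m₂ a) (v₂ a) (y a) := by
  unfold LEGFilter.gaussianRatio
  fun_prop

lemma lintegral_mul_gaussianRatio {E : Type*} [NormedAddCommGroup E] [NormedSpace ℝ E]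
    [CompleteSpace E] [MeasurableSpace E] [BorelSpace E] [SecondCountableTopology E]
    {γ ρ : Measure E} [IsGaussian γ] [IsGaussian ρ] {η : StrongDual ℝ E} (hγ : 0 < Var[η; γ])
    (hρ : 0 < Var[η; ρ]) {Φ : ℝ → ℝ≥0∞} (hΦ : Measurable Φ) :
    ∫⁻ v, Φ (η v) * ENNReal.ofReal (gaussianRatio γ[η] Var[η; γ] ρ[η] Var[η; ρ] (η v)) ∂γ
      = ∫⁻ v, Φ (η v) ∂ρ := by
  have hm : Measurable fun y => ENNReal.ofReal (gaussianRatio γ[η] Var[η; γ] ρ[η] Var[η; ρ] y) :=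
    (Measurable.gaussianRatio measurable_const measurable_const measurable_const measurable_const
      measurable_id).ennreal_ofReal
  have h1 := gaussianReal_withDensity_ratio γ[η] ρ[η] (v₁ := (Var[η; γ]).toNNReal)
    (v₂ := (Var[η; ρ]).toNNReal) (by simpa using hγ) (by simpa using hρ)
  rw [Real.coe_toNNReal _ hγ.le, Real.coe_toNNReal _ hρ.le, ← IsGaussian.map_eq_gaussianReal,
    ← IsGaussian.map_eq_gaussianReal] at h1
  change (Measure.withDensity _ fun y =>
    ENNReal.ofReal (gaussianRatio γ[η] Var[η; γ] ρ[η] Var[η; ρ] y)) = _ at h1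
  rw [← lintegral_map hΦ (by fun_prop), ← h1, lintegral_withDensity_eq_lintegral_mul _ hm hΦ,
    lintegral_map (hm.mul hΦ) (by fun_prop)]
  refine lintegral_congr fun v => ?_
  rw [mul_comm]
  rfl

/-! ### One filtering step: identification of the means and variances -/

/-- The standing assumptions on the processes, the noise and the coefficients. -/
structure IsFilteringModel {Ω : Type*} {mΩ : MeasurableSpace Ω} (P : Measure Ω)
    (X Y ε h : ℕ → Ω → ℝ) (Q : ℕ → ℝ) : Prop where
  measurable_X : ∀ t, 1 ≤ t → Measurable (X t)
  measurable_Y : ∀ t, 1 ≤ t → Measurable (Y t)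
  noise : IsAuxiliaryNoise P X Y ε
  nonneg : ∀ t, 1 ≤ t → 0 ≤ Q t
  measurable_h : ∀ t, 1 ≤ t → Measurable[pastSigma Y t] (h t)

/-- `κ` is a conditional law of `V` given `Y_1, …, Y_n`, almost surely Gaussian, and
`X_1, …, X_{n+1}, Y_{n+1}` are linear functionals of `V`. -/
structure IsGaussianPrediction {Ω E : Type*} {mΩ : MeasurableSpace Ω} [NormedAddCommGroup E]
    [NormedSpace ℝ E] [MeasurableSpace E] (P : Measure Ω) (X Y : ℕ → Ω → ℝ) (V : Ω → E)
    (κ : Ω → Measure E) (ℓ : ℕ → StrongDual ℝ E) (η : StrongDual ℝ E) (n : ℕ) : Prop where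
  isCondLaw : IsCondLaw (pastSigma Y n) P V κ
  gaussian : ∀ᵐ ω ∂P, IsGaussian (κ ω)
  measurable : Measurable[processSigma X Y] V
  X_eq : ∀ s, 1 ≤ s → s ≤ n + 1 → ∀ ω, X s ω = ℓ s (V ω)
  Y_eq : ∀ ω, Y (n + 1) ω = η (V ω)

section Step

variable {Ω E : Type*} {mΩ : MeasurableSpace Ω} {P : Measure Ω} [IsProbabilityMeasure P]
  {X Y ε h : ℕ → Ω → ℝ} {Q : ℕ → ℝ}
  [NormedAddCommGroup E] [NormedSpace ℝ E] [CompleteSpace E]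
  [mE : MeasurableSpace E] [BorelSpace E] [SecondCountableTopology E]
  {V : Ω → E} {κ : Ω → Measure E} {ℓ : ℕ → StrongDual ℝ E} {η : StrongDual ℝ E} {n : ℕ}

lemma IsFilteringModel.pastSigma_le (H : IsFilteringModel P X Y ε h Q) (t : ℕ) :
    pastSigma Y t ≤ mΩ := LEGFilter.pastSigma_le fun s hs _ => H.measurable_Y s hs

lemma IsFilteringModel.measurable_auxObs (H : IsFilteringModel P X Y ε h Q) {t : ℕ} (ht : 1 ≤ t) :
    Measurable (auxObs X ε h Q t) :=
  (((H.measurable_X t ht).sub ((H.measurable_h t ht).mono (H.pastSigma_le t) le_rfl)).const_mul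
    _).add ((H.noise.measurable t ht).const_mul _)

lemma IsFilteringModel.auxSigma_le (H : IsFilteringModel P X Y ε h Q) (t u : ℕ) :
    auxSigma X Y ε h Q t u ≤ mΩ :=
  sup_le (H.pastSigma_le t) (LEGFilter.pastSigma_le fun _ hs _ => H.measurable_auxObs hs)

lemma pastSigma_le_processSigma (t : ℕ) : pastSigma Y t ≤ processSigma X Y :=
  LEGFilter.pastSigma_le fun _ hs _ => measurable_processSigma_right hs

namespace IsGaussianPrediction

lemma isCondLaw_succ (G : IsGaussianPrediction P X Y V κ ℓ η n) :
    IsCondLaw (pastSigma Y (n + 1)) P V (fun ω => condOn (κ ω) η (Y (n + 1) ω)) := by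
  have := G.isCondLaw.condOn G.gaussian η
  simpa only [← G.Y_eq, ← pastSigma_succ] using this

lemma gaussian_succ (G : IsGaussianPrediction P X Y V κ ℓ η n) :
    ∀ᵐ ω ∂P, IsGaussian (condOn (κ ω) η (Y (n + 1) ω)) := by
  filter_upwards [G.gaussian] with ω hω using inferInstance

/-- The law `κ ω` weighted by the auxiliary observations. -/
noncomputable def _root_.LEGFilter.barLaw (X ε h : ℕ → Ω → ℝ) (Q : ℕ → ℝ) (κ : Ω → Measure E)
    (ℓ : ℕ → StrongDual ℝ E) (n : ℕ) (ω : Ω) : Measure E :=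
  weighted (κ ω) (prodWeight Q (fun s => auxObs X ε h Q s ω) (fun s => h s ω) ℓ n)

/-- The law `κ ω` weighted by vanishing auxiliary observations. -/
noncomputable def _root_.LEGFilter.nullLaw (h : ℕ → Ω → ℝ) (Q : ℕ → ℝ) (κ : Ω → Measure E)
    (ℓ : ℕ → StrongDual ℝ E) (n : ℕ) (ω : Ω) : Measure E :=
  weighted (κ ω) (prodWeight Q 0 (fun s => h s ω) ℓ n)

variable (H : IsFilteringModel P X Y ε h Q) (G : IsGaussianPrediction P X Y V κ ℓ η n)

include H G

lemma isCondLaw_bar : IsCondLaw (auxSigma X Y ε h Q n n) P V (barLaw X ε h Q κ ℓ n) :=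
  G.isCondLaw.sup_pastSigma_auxObs G.gaussian H.measurable_X H.measurable_Y H.noise H.nonneg
    (pastSigma_le_processSigma n) G.measurable
    (fun s h1 h2 => (H.measurable_h s h1).mono (pastSigma_mono _ h2) le_rfl) ℓ
    (fun s h1 h2 => G.X_eq s h1 (by omega))

lemma isCondLaw_bar_succ : IsCondLaw (auxSigma X Y ε h Q (n + 1) n) P V
    (barLaw X ε h Q (fun ω => condOn (κ ω) η (Y (n + 1) ω)) ℓ n) :=
  G.isCondLaw_succ.sup_pastSigma_auxObs G.gaussian_succ H.measurable_X H.measurable_Y H.noise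
    H.nonneg (pastSigma_le_processSigma _) G.measurable
    (fun s h1 h2 => (H.measurable_h s h1).mono (pastSigma_mono _ (by omega)) le_rfl) ℓ
    (fun s h1 h2 => G.X_eq s h1 (by omega))

omit G in
lemma gaussian_barLaw {κ : Ω → Measure E} (hκ : ∀ᵐ ω ∂P, IsGaussian (κ ω)) :
    ∀ᵐ ω ∂P, IsGaussian (barLaw X ε h Q κ ℓ n ω) := by
  filter_upwards [hκ] with ω hω using (weighted_prodWeight_spec H.nonneg _ _ ℓ (κ ω) n).1

omit [IsProbabilityMeasure P] in
lemma xi_eq (ω : Ω) : xi X ε h Q n ω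
    = (∑ s ∈ Finset.Icc 1 n, auxObs X ε h Q s ω * ℓ s (V ω))
      - ∑ s ∈ Finset.Icc 1 n, auxObs X ε h Q s ω * h s ω := by
  rw [xi, ← Finset.sum_sub_distrib]
  refine Finset.sum_congr rfl fun s hs => ?_
  obtain ⟨h1, h2⟩ := Finset.mem_Icc.1 hs
  rw [G.X_eq s h1 (by omega)]
  ring

omit G [IsProbabilityMeasure P] in
lemma measurable_sum_auxObs_mul : Measurable[auxSigma X Y ε h Q n n]
    fun ω => ∑ s ∈ Finset.Icc 1 n, auxObs X ε h Q s ω * h s ω := by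
  have h1 : ∀ s ∈ Finset.Icc 1 n, Measurable[auxSigma X Y ε h Q n n] (auxObs X ε h Q s) :=
    fun s hs => (measurable_pastSigma (Finset.mem_Icc.1 hs).1 (Finset.mem_Icc.1 hs).2).mono
      le_sup_right le_rfl
  have h2 : ∀ s ∈ Finset.Icc 1 n, Measurable[auxSigma X Y ε h Q n n] (h s) :=
    fun s hs => (H.measurable_h s (Finset.mem_Icc.1 hs).1).mono
      ((pastSigma_mono _ (Finset.mem_Icc.1 hs).2).trans le_sup_left) le_rfl
  let _ := auxSigma X Y ε h Q n n
  exact Finset.measurable_sum _ fun s hs => (h1 s hs).mul (h2 s hs)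

-- Given 𝒴̄_n, the error of `ξ` differs from the linear form with coefficients `auxObs` only by a
-- known term. This is the form required by `condMean_mul`.
omit [IsProbabilityMeasure P] in
lemma exists_errXi_eq : ∃ c : Ω → ℝ, Measurable[auxSigma X Y ε h Q n n] c ∧
    ∀ ω, errXi P X Y ε h Q (n + 1) ω
      = (∑ s ∈ Finset.Icc 1 n, auxObs X ε h Q s ω * ℓ s (V ω)) - c ω :=
  ⟨_, Measurable.add (measurable_sum_auxObs_mul H) (measurable_condMean (xi X ε h Q n)),
    fun ω => by
      simp only [errXi, Nat.add_sub_cancel, xi_eq H G ω, Pi.add_apply]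
      ring⟩

lemma condMean_Y : CondIntegrable (pastSigma Y n) P (Y (n + 1))
    ∧ condMean (pastSigma Y n) P (Y (n + 1)) =ᵐ[P] fun ω => (κ ω)[η] :=
  G.isCondLaw.condMean_dual (H.pastSigma_le n) G.gaussian G.Y_eq

lemma condSigmaSq_eq : CondIntegrable (pastSigma Y n) P (fun ω => errY P Y (n + 1) ω ^ 2)
    ∧ condSigmaSq P Y (n + 1) =ᵐ[P] fun ω => covarianceBilinDual (κ ω) η η :=
  G.isCondLaw.condMean_sq (H.pastSigma_le n) G.gaussian G.Y_eq

lemma condSigmaBarSq_eq :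
    CondIntegrable (auxSigma X Y ε h Q n n) P (fun ω => errYBar P X Y ε h Q (n + 1) ω ^ 2)
    ∧ condSigmaBarSq P X Y ε h Q (n + 1) =ᵐ[P] fun ω =>
      covarianceBilinDual (nullLaw h Q κ ℓ n ω) η η := by
  have := (isCondLaw_bar H G).condMean_sq (H.auxSigma_le n n) (gaussian_barLaw H G.gaussian) G.Y_eq
  refine ⟨this.1, this.2.trans ?_⟩
  filter_upwards [G.gaussian] with ω hω
  -- Covariances ignore the linear terms, so the observed values may be replaced by zero.
  exact covarianceBilinDual_weighted_prodWeight_congr H.nonneg _ _ ℓ (fun _ _ => rfl) _ _ n η η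

lemma condGammaTilde_eq :
    CondIntegrable (auxSigma X Y ε h Q (n + 1) n) P (fun ω => errX P X Y ε h Q (n + 1) ω ^ 2)
    ∧ condGammaTilde P X Y ε h Q (n + 1) =ᵐ[P] fun ω => covarianceBilinDual
      (nullLaw h Q (fun ω => condOn (κ ω) η (Y (n + 1) ω)) ℓ n ω) (ℓ (n + 1)) (ℓ (n + 1)) := by
  have := (isCondLaw_bar_succ H G).condMean_sq (H.auxSigma_le (n + 1) n)
    (gaussian_barLaw H G.gaussian_succ) (G.X_eq (n + 1) (by omega) le_rfl)
  refine ⟨this.1, this.2.trans ?_⟩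
  filter_upwards [G.gaussian_succ] with ω hω
  exact covarianceBilinDual_weighted_prodWeight_congr H.nonneg _ _ ℓ (fun _ _ => rfl) _ _ n _ _

/-- Subtracting the covariance with `ξ` undoes the linear part of the weights, by
`integral_weighted_prodWeight_zero`. The correction in V̄ therefore removes the dependence on the
auxiliary observations. -/
lemma vBar_eq :
    CondIntegrable (auxSigma X Y ε h Q n n) P
      (fun ω => errYBar P X Y ε h Q (n + 1) ω * errXi P X Y ε h Q (n + 1) ω)
    ∧ vBar P X Y ε h Q (n + 1) =ᵐ[P] fun ω => (nullLaw h Q κ ℓ n ω)[η] := by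
  obtain ⟨c, hc, hcξ⟩ := exists_errXi_eq H G
  have hb := isCondLaw_bar H G
  have hz : ∀ s, 1 ≤ s → s ≤ n → Measurable[auxSigma X Y ε h Q n n] (auxObs X ε h Q s) :=
    fun s h1 h2 => (measurable_pastSigma h1 h2).mono le_sup_right le_rfl
  have h1 := hb.condMean_dual (H.auxSigma_le n n) (gaussian_barLaw H G.gaussian) G.Y_eq
  have h2 := hb.condMean_mul (H.auxSigma_le n n) (gaussian_barLaw H G.gaussian) G.Y_eq hz hc hcξ
  refine ⟨h2.1, ?_⟩
  filter_upwards [G.gaussian, h1.2, h2.2] with ω hω e1 e2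
  have e3 := integral_weighted_prodWeight_zero H.nonneg (fun s => auxObs X ε h Q s ω)
    (fun s => h s ω) ℓ (κ ω) n η
  exact (congrArg₂ (· - ·) e1 e2).trans e3.symm

/-- Same mechanism as for `vBar_eq`, starting from the law conditioned on Y_{n+1} as well. The
centring of `ξ` is relative to the smaller σ-algebra 𝒴̄_n, which is harmless because it is known
given the larger one. -/
lemma zTilde_eq :
    CondIntegrable (auxSigma X Y ε h Q (n + 1) n) P
      (fun ω => errX P X Y ε h Q (n + 1) ω * errXi P X Y ε h Q (n + 1) ω)
    ∧ zTilde P X Y ε h Q (n + 1) =ᵐ[P] fun ω =>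
      (nullLaw h Q (fun ω => condOn (κ ω) η (Y (n + 1) ω)) ℓ n ω)[ℓ (n + 1)] := by
  obtain ⟨c, hc, hcξ⟩ := exists_errXi_eq H G
  have hb := isCondLaw_bar_succ H G
  have hle : auxSigma X Y ε h Q n n ≤ auxSigma X Y ε h Q (n + 1) n :=
    sup_le_sup (pastSigma_mono _ (by omega)) le_rfl
  have hz : ∀ s, 1 ≤ s → s ≤ n → Measurable[auxSigma X Y ε h Q (n + 1) n] (auxObs X ε h Q s) :=
    fun s h1 h2 => (measurable_pastSigma h1 h2).mono le_sup_right le_rfl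
  have hX := G.X_eq (n + 1) (by omega) le_rfl
  have h1 := hb.condMean_dual (H.auxSigma_le _ _) (gaussian_barLaw H G.gaussian_succ) hX
  have h2 := hb.condMean_mul (H.auxSigma_le _ _) (gaussian_barLaw H G.gaussian_succ) hX hz
    (hc.mono hle le_rfl) hcξ
  refine ⟨h2.1, ?_⟩
  filter_upwards [G.gaussian_succ, h1.2, h2.2] with ω hω e1 e2
  have e3 := integral_weighted_prodWeight_zero H.nonneg (fun s => auxObs X ε h Q s ω)
    (fun s => h s ω) ℓ (condOn (κ ω) η (Y (n + 1) ω)) n (ℓ (n + 1))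
  exact (congrArg₂ (· - ·) e1 e2).trans e3.symm

lemma momentsExist : MomentsExist P X Y ε h Q (n + 1) where
  predY := (condMean_Y H G).1
  predYBar := ((isCondLaw_bar H G).condMean_dual (H.auxSigma_le n n)
    (gaussian_barLaw H G.gaussian) G.Y_eq).1
  filterX := ((isCondLaw_bar_succ H G).condMean_dual (H.auxSigma_le _ _)
    (gaussian_barLaw H G.gaussian_succ) (G.X_eq (n + 1) (by omega) le_rfl)).1
  predXi := (isCondLaw_bar H G).condMean_sum_smul (H.auxSigma_le n n)
    (gaussian_barLaw H G.gaussian)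
    (fun s h1 h2 => (measurable_pastSigma h1 h2).mono le_sup_right le_rfl)
    (measurable_sum_auxObs_mul H) (xi_eq H G)
  covXXi := (zTilde_eq H G).1
  covYXi := (vBar_eq H G).1
  varY := (condSigmaSq_eq H G).1
  varYBar := (condSigmaBarSq_eq H G).1
  varX := (condGammaTilde_eq H G).1

lemma condSigmaBarSq_pos (hpos : ∀ᵐ ω ∂P, 0 < condSigmaSq P Y (n + 1) ω) :
    ∀ᵐ ω ∂P, 0 < condSigmaBarSq P X Y ε h Q (n + 1) ω := by
  filter_upwards [G.gaussian, hpos, (condSigmaSq_eq H G).2, (condSigmaBarSq_eq H G).2]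
    with ω hω h0 e1 e2
  rw [e2]
  exact covarianceBilinDual_weighted_prodWeight_pos H.nonneg _ _ ℓ (κ ω) n (e1 ▸ h0)

end IsGaussianPrediction

end Step

/-! ### The recursion for the conditional Laplace transform -/

section Laplace

variable {Ω E : Type*} {mΩ : MeasurableSpace Ω} {P : Measure Ω} [IsProbabilityMeasure P]
  {X Y ε h : ℕ → Ω → ℝ} {Q : ℕ → ℝ}
  [NormedAddCommGroup E] [NormedSpace ℝ E] [CompleteSpace E]
  [mE : MeasurableSpace E] [BorelSpace E] [SecondCountableTopology E]
  {V : Ω → E} {κ : Ω → Measure E} {ℓ : ℕ → StrongDual ℝ E} {η : StrongDual ℝ E} {n : ℕ}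

/-- `exp (-½ ∑_{s ≤ T} (X_s - h_s)² Q_s)` as a nonnegative extended real variable. -/
noncomputable def energyWeight (X h : ℕ → Ω → ℝ) (Q : ℕ → ℝ) (T : ℕ) (ω : Ω) : ℝ≥0∞ :=
  ∏ s ∈ Finset.Icc 1 T, expQuad (Q s) 0 (h s ω) (X s ω)

/-- The conditional expectation of `energyWeight` given the observations up to time `T`. -/
noncomputable def laplace (P : Measure Ω) (X Y h : ℕ → Ω → ℝ) (Q : ℕ → ℝ) (T : ℕ) : Ω → ℝ≥0∞ :=
  condLExp (pastSigma Y T) P (energyWeight X h Q T)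

/-- The density of `nullLaw` with respect to `κ` as a function of the next observation. -/
noncomputable def predictionRatio (h : ℕ → Ω → ℝ) (Q : ℕ → ℝ) (κ : Ω → Measure E)
    (ℓ : ℕ → StrongDual ℝ E) (η : StrongDual ℝ E) (n : ℕ) (ω : Ω) (y : ℝ) : ℝ :=
  gaussianRatio (κ ω)[η] Var[η; κ ω] (nullLaw h Q κ ℓ n ω)[η] Var[η; nullLaw h Q κ ℓ n ω] y

omit [IsProbabilityMeasure P] in
lemma measurable_uncurry_energyWeight {m : MeasurableSpace Ω} {t : ℕ}
    (hh : ∀ s, 1 ≤ s → s ≤ t → Measurable[m] (h s)) :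
    Measurable[m.prod mE] fun p : Ω × E => prodWeight Q 0 (fun s => h s p.1) ℓ t p.2 := by
  let _ := m
  exact measurable_uncurry_prodWeight (Q := Q) (z := fun _ _ => (0 : ℝ)) ℓ
    (fun _ _ _ => measurable_const) hh

omit [IsProbabilityMeasure P] in
lemma isGaussian_nullLaw (H : IsFilteringModel P X Y ε h Q) (ω : Ω) [IsGaussian (κ ω)] :
    IsGaussian (nullLaw h Q κ ℓ n ω) := (weighted_prodWeight_spec H.nonneg 0 _ ℓ (κ ω) n).1

namespace IsGaussianPrediction

variable (H : IsFilteringModel P X Y ε h Q) (G : IsGaussianPrediction P X Y V κ ℓ η n)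

include H G

omit H [IsProbabilityMeasure P] in
lemma energyWeight_eq {t : ℕ} (ht : t ≤ n + 1) :
    energyWeight X h Q t = fun ω => prodWeight Q 0 (fun s => h s ω) ℓ t (V ω) := by
  ext ω
  refine Finset.prod_congr rfl fun s hs => ?_
  obtain ⟨h1, h2⟩ := Finset.mem_Icc.1 hs
  rw [G.X_eq s h1 (by omega)]
  rfl

lemma laplace_eq : laplace P X Y h Q n
    =ᵐ[P] fun ω => ∫⁻ v, prodWeight Q 0 (fun s => h s ω) ℓ n v ∂κ ω := by
  rw [laplace, G.energyWeight_eq (by omega)]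
  exact G.isCondLaw.condLExp_ae_eq (H.pastSigma_le n) (measurable_uncurry_energyWeight
    fun s h1 h2 => (H.measurable_h s h1).mono (pastSigma_mono _ h2) le_rfl)

lemma measurable_predictionRatio : Measurable[(pastSigma Y n).prod inferInstance]
    fun p : Ω × ℝ => predictionRatio h Q κ ℓ η n p.1 p.2 := by
  have h1 : ∀ s, 1 ≤ s → s ≤ n → Measurable[pastSigma Y n] (h s) :=
    fun s h1 h2 => (H.measurable_h s h1).mono (pastSigma_mono _ h2) le_rfl
  have hκ := G.isCondLaw.measurable
  have hκ1 := G.isCondLaw.mass_le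
  have hw := measurable_uncurry_energyWeight (ℓ := ℓ) (Q := Q) h1
  let _ := pastSigma Y n
  have hρ : Measurable (nullLaw h Q κ ℓ n) := measurable_weighted hκ hκ1 hw
  have hρ1 : ∀ ω, nullLaw h Q κ ℓ n ω Set.univ ≤ 1 := fun ω => weighted_univ_le _ _
  have hη : Measurable fun p : Ω × E => η p.2 := η.measurable.comp measurable_snd
  exact Measurable.gaussianRatio ((measurable_integral_family hκ hκ1 hη).comp measurable_fst)
    ((measurable_variance_family hκ hκ1 η.measurable).comp measurable_fst)
    ((measurable_integral_family hρ hρ1 hη).comp measurable_fst)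
    ((measurable_variance_family hρ hρ1 η.measurable).comp measurable_fst) measurable_snd

lemma lintegral_mul_predictionRatio (hpos : ∀ᵐ ω ∂P, 0 < condSigmaSq P Y (n + 1) ω) :
    ∀ᵐ ω ∂P, ∀ Φ : ℝ → ℝ≥0∞, Measurable Φ →
      ∫⁻ v, Φ (η v) * ENNReal.ofReal (predictionRatio h Q κ ℓ η n ω (η v)) ∂κ ω
        = ∫⁻ v, Φ (η v) ∂(nullLaw h Q κ ℓ n ω) := by
  filter_upwards [G.gaussian, hpos, (condSigmaSq_eq H G).2] with ω hω h0 e1 Φ hΦ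
  have : IsGaussian (weighted (κ ω) (prodWeight Q 0 (fun s => h s ω) ℓ n)) :=
    isGaussian_nullLaw H ω
  rw [e1] at h0
  have h1 := covarianceBilinDual_weighted_prodWeight_pos H.nonneg 0 (fun s => h s ω) ℓ (κ ω) n h0
  rw [covarianceBilinDual_self_eq_var] at h0 h1
  exact lintegral_mul_gaussianRatio h0 h1 hΦ

lemma predictionRatio_ae_eq : (fun ω => predictionRatio h Q κ ℓ η n ω (Y (n + 1) ω))
    =ᵐ[P] fun ω => martingaleFactor P X Y ε h Q (condSigmaSq P Y (n + 1) ω)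
      (condSigmaBarSq P X Y ε h Q (n + 1) ω) (n + 1) ω := by
  filter_upwards [G.gaussian, (condSigmaSq_eq H G).2, (condSigmaBarSq_eq H G).2, (vBar_eq H G).2,
    (condMean_Y H G).2] with ω hω e1 e2 e3 e4
  have := isGaussian_nullLaw (κ := κ) (ℓ := ℓ) (n := n) H ω
  have e5 := covarianceBilinDual_self_eq_var (nullLaw h Q κ ℓ n ω) η
  rw [covarianceBilinDual_self_eq_var] at e1
  rw [martingaleFactor, Nat.add_sub_cancel, e1, e2, e3, e4, e5]
  rfl

/-- The martingale property in integrated form: under κ the density ratio turns the predictive law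
of Y_{n+1} into another probability law, so it has conditional mean one given 𝒴_n. -/
lemma lintegral_mul_predictionRatio_obs (hpos : ∀ᵐ ω ∂P, 0 < condSigmaSq P Y (n + 1) ω)
    {g : Ω → ℝ≥0∞} (hg : Measurable[pastSigma Y n] g) :
    ∫⁻ ω, g ω * ENNReal.ofReal (predictionRatio h Q κ ℓ η n ω (Y (n + 1) ω)) ∂P
      = ∫⁻ ω, g ω ∂P := by
  have hm := measurable_predictionRatio H G
  have hF : Measurable[(pastSigma Y n).prod mE] fun p : Ω × E =>
      g p.1 * ENNReal.ofReal (predictionRatio h Q κ ℓ η n p.1 (η p.2)) := by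
    let _ := pastSigma Y n
    have := hm.comp (measurable_fst.prodMk (η.measurable.comp (measurable_snd (α := Ω) (β := E))))
    exact (hg.comp measurable_fst).mul this.ennreal_ofReal
  simp only [G.Y_eq]
  rw [G.isCondLaw.lintegral_eq _ hF]
  refine lintegral_congr_ae ?_
  filter_upwards [G.gaussian, lintegral_mul_predictionRatio H G hpos] with ω hω h1
  have := isGaussian_nullLaw (κ := κ) (ℓ := ℓ) (n := n) H ω
  simpa using h1 (fun _ => g ω) measurable_const

/-- The one step recursion of the conditional Laplace transform. -/
lemma laplace_succ (hpos : ∀ᵐ ω ∂P, 0 < condSigmaSq P Y (n + 1) ω) :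
    laplace P X Y h Q (n + 1) =ᵐ[P] fun ω => laplace P X Y h Q n ω
      * ENNReal.ofReal (martingaleFactor P X Y ε h Q (condSigmaSq P Y (n + 1) ω)
        (condSigmaBarSq P X Y ε h Q (n + 1) ω) (n + 1) ω)
      * ENNReal.ofReal
        (mainFactor P X Y ε h Q (condGammaTilde P X Y ε h Q (n + 1) ω) (n + 1) ω) := by
  have hh : ∀ {t}, t ≤ n + 1 → ∀ s, 1 ≤ s → s ≤ t → Measurable[pastSigma Y t] (h s) :=
    fun _ s h1 h2 => (H.measurable_h s h1).mono (pastSigma_mono _ h2) le_rfl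
  have hh' : ∀ {t}, t ≤ n + 1 → ∀ s, 1 ≤ s → s ≤ t → Measurable[pastSigma Y (n + 1)] (h s) :=
    fun ht s h1 h2 => (hh ht s h1 h2).mono (pastSigma_mono _ ht) le_rfl
  have hw := measurable_uncurry_energyWeight (ℓ := ℓ) (Q := Q) (hh (t := n) (by omega))
  -- the conditional expectation of the weight at time `n` given `Y_1, …, Y_{n+1}`, in two ways
  have h1 := G.isCondLaw_succ.condLExp_ae_eq (H.pastSigma_le (n + 1))
    (measurable_uncurry_energyWeight (ℓ := ℓ) (Q := Q) (hh' (t := n) (by omega)))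
  have h2 := G.isCondLaw_succ.condLExp_ae_eq (H.pastSigma_le (n + 1))
    (measurable_uncurry_energyWeight (ℓ := ℓ) (Q := Q) (hh (t := n + 1) le_rfl))
  have hI : Measurable[pastSigma Y n] fun ω =>
      ∫⁻ v, prodWeight Q 0 (fun s => h s ω) ℓ n v ∂κ ω :=
    @measurable_lintegral_family Ω E (pastSigma Y n) mE κ G.isCondLaw.measurable
      G.isCondLaw.mass_le _ hw
  have hR : Measurable[(pastSigma Y n).prod inferInstance] fun p : Ω × ℝ =>
      (∫⁻ v, prodWeight Q 0 (fun s => h s p.1) ℓ n v ∂κ p.1)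
        * ENNReal.ofReal (predictionRatio h Q κ ℓ η n p.1 p.2) := by
    have hm := measurable_predictionRatio H G
    let _ := pastSigma Y n
    exact (hI.comp measurable_fst).mul hm.ennreal_ofReal
  have hηV : Measurable fun ω => η (V ω) := by
    simpa only [← G.Y_eq] using H.measurable_Y (n + 1) (by omega)
  -- Weighting κ by w_n gives its total mass times `nullLaw`, and the image of `nullLaw` under `η`
  -- has density `predictionRatio` with respect to that of κ.
  have h3 := G.isCondLaw.condLExp_sup_comap (H.pastSigma_le n) η.measurable hηV hw hR (by
    filter_upwards [G.gaussian, lintegral_mul_predictionRatio H G hpos] with ω hω e1 Φ hΦ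
    obtain ⟨-, k0, k1⟩ := weighted_prodWeight_spec H.nonneg 0 (fun s => h s ω) ℓ (κ ω) n
    have e2 := lintegral_mul_eq_mul_lintegral_weighted (by fun_prop) k0 k1
      (f := fun v => Φ (η v)) (by fun_prop)
    have e3 := e1 Φ hΦ
    simp only [mul_comm (Φ _)] at e3 ⊢
    rw [e2]
    change _ * ∫⁻ v, Φ (η v) ∂(nullLaw h Q κ ℓ n ω) = _
    rw [← e3]
    simp only [mul_assoc]
    rw [lintegral_const_mul' _ _ k1])
  simp only [← G.Y_eq, ← pastSigma_succ] at h3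
  rw [laplace, G.energyWeight_eq le_rfl]
  filter_upwards [h1, h2, h3, laplace_eq H G, G.gaussian_succ, predictionRatio_ae_eq H G,
    (condGammaTilde_eq H G).2, (zTilde_eq H G).2] with ω e1 e2 e3 e4 hω e5 e6 e7
  rw [e2, e4, ← e5, ← e3, e1, mainFactor, e6, e7]
  obtain ⟨g, k0, k1⟩ := weighted_prodWeight_spec H.nonneg 0 (fun s => h s ω) ℓ
    (condOn (κ ω) η (Y (n + 1) ω)) n
  -- The factor of index `n + 1` is split off only after conditioning on Y_{n+1}, on which h_{n+1}
  -- may depend. What remains is its integral against a Gaussian law, the mass `expQuadMass` with `z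
  -- = 0`.
  rw [prodWeight_succ, lintegral_mul_eq_mul_lintegral_weighted (by fun_prop) k0 k1 (by fun_prop)]
  congr 1
  have := isGaussian_nullLaw (κ := fun ω => condOn (κ ω) η (Y (n + 1) ω)) (ℓ := ℓ) (n := n) H ω
  have := lintegral_expQuad_dual (nullLaw h Q (fun ω => condOn (κ ω) η (Y (n + 1) ω)) ℓ n ω)
    (ℓ (n + 1)) (H.nonneg (n + 1) (by omega)) 0 (h (n + 1) ω)
  refine this.trans ?_
  rw [expQuadMass]
  congr 3
  ring

end IsGaussianPrediction

end Laplace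

/-! ### Product formula and martingale property -/

/-- What holds at time `n + 1` when the prediction from the observations up to time `n` is Gaussian
and nondegenerate. -/
structure HasGaussianStep {Ω : Type*} {mΩ : MeasurableSpace Ω} (P : Measure Ω)
    (X Y ε h : ℕ → Ω → ℝ) (Q : ℕ → ℝ) (n : ℕ) : Prop where
  momentsExist : MomentsExist P X Y ε h Q (n + 1)
  condSigmaBarSq_pos : ∀ᵐ ω ∂P, 0 < condSigmaBarSq P X Y ε h Q (n + 1) ω
  condGammaTilde_nonneg : ∀ᵐ ω ∂P, 0 ≤ condGammaTilde P X Y ε h Q (n + 1) ω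
  laplace_succ : laplace P X Y h Q (n + 1) =ᵐ[P] fun ω => laplace P X Y h Q n ω
    * ENNReal.ofReal (martingaleFactor P X Y ε h Q (condSigmaSq P Y (n + 1) ω)
      (condSigmaBarSq P X Y ε h Q (n + 1) ω) (n + 1) ω)
    * ENNReal.ofReal (mainFactor P X Y ε h Q (condGammaTilde P X Y ε h Q (n + 1) ω) (n + 1) ω)
  exists_ratio : ∃ R : Ω → ℝ, Measurable[pastSigma Y (n + 1)] R ∧ (∀ ω, 0 ≤ R ω)
    ∧ (∀ g : Ω → ℝ≥0∞, Measurable[pastSigma Y n] g →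
      ∫⁻ ω, g ω * ENNReal.ofReal (R ω) ∂P = ∫⁻ ω, g ω ∂P)
    ∧ (fun ω => martingaleFactor P X Y ε h Q (condSigmaSq P Y (n + 1) ω)
      (condSigmaBarSq P X Y ε h Q (n + 1) ω) (n + 1) ω) =ᵐ[P] R

section

variable {Ω : Type*} {mΩ : MeasurableSpace Ω} {P : Measure Ω} [IsProbabilityMeasure P]
  {X Y ε h : ℕ → Ω → ℝ} {Q : ℕ → ℝ}

lemma measurable_comp_prodMk {m m' : MeasurableSpace Ω} (hm : m ≤ m') {f : Ω × ℝ → ℝ}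
    (hf : Measurable[m.prod inferInstance] f) {y : Ω → ℝ} (hy : Measurable[m'] y) :
    Measurable[m'] fun ω => f (ω, y ω) :=
  have h1 : Measurable[m', m.prod inferInstance] fun ω => (ω, y ω) :=
    @Measurable.prodMk _ m' _ _ m _ _ _ (measurable_id'' hm) hy
  hf.comp h1

lemma IsGaussianPrediction.hasGaussianStep {E : Type*}
    [NormedAddCommGroup E] [NormedSpace ℝ E] [CompleteSpace E]
    [mE : MeasurableSpace E] [BorelSpace E] [SecondCountableTopology E]
    {V : Ω → E} {κ : Ω → Measure E} {ℓ : ℕ → StrongDual ℝ E} {η : StrongDual ℝ E} {n : ℕ}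
    (H : IsFilteringModel P X Y ε h Q) (G : IsGaussianPrediction P X Y V κ ℓ η n)
    (hpos : ∀ᵐ ω ∂P, 0 < condSigmaSq P Y (n + 1) ω) : HasGaussianStep P X Y ε h Q n where
  momentsExist := momentsExist H G
  condSigmaBarSq_pos := condSigmaBarSq_pos H G hpos
  condGammaTilde_nonneg := by
    filter_upwards [(condGammaTilde_eq H G).2] with ω hω
    rw [hω]
    exact covarianceBilinDual_self_nonneg _
  laplace_succ := laplace_succ H G hpos
  exists_ratio := by
    refine ⟨fun ω => predictionRatio h Q κ ℓ η n ω (Y (n + 1) ω), ?_, fun ω => ?_,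
      fun g hg => lintegral_mul_predictionRatio_obs H G hpos hg, (predictionRatio_ae_eq H G).symm⟩
    · exact measurable_comp_prodMk (pastSigma_mono _ (by omega))
        (f := fun p => predictionRatio h Q κ ℓ η n p.1 p.2) (measurable_predictionRatio H G)
        (measurable_pastSigma (by omega) le_rfl)
    · exact gaussianRatio_nonneg (variance_nonneg _ _) (variance_nonneg _ _) _ _ _

lemma toReal_energyWeight (T : ℕ) (ω : Ω) : (energyWeight X h Q T ω).toReal
    = Real.exp (-(1 / 2) * ∑ s ∈ Finset.Icc 1 T, (X s ω - h s ω) ^ 2 * Q s) := by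
  simp only [energyWeight, expQuad, ENNReal.toReal_prod, Finset.mul_sum, Real.exp_sum,
    ENNReal.toReal_ofReal (Real.exp_pos _).le]
  refine Finset.prod_congr rfl fun s _ => congrArg _ ?_
  ring

lemma energyWeight_le_one (H : IsFilteringModel P X Y ε h Q) (T : ℕ) (ω : Ω) :
    energyWeight X h Q T ω ≤ 1 := by
  refine Finset.prod_le_one (fun _ _ => zero_le) fun s hs => ?_
  have := H.nonneg s (Finset.mem_Icc.1 hs).1
  rw [expQuad, ENNReal.ofReal_le_one, Real.exp_le_one_iff]
  have : 0 ≤ Q s * (X s ω - h s ω) ^ 2 / 2 := by positivity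
  linarith

lemma measurable_energyWeight (H : IsFilteringModel P X Y ε h Q) (T : ℕ) :
    Measurable (energyWeight X h Q T) := by
  unfold energyWeight
  refine Finset.measurable_prod _ fun s hs => ?_
  have h1 := (Finset.mem_Icc.1 hs).1
  exact Measurable.expQuad measurable_const measurable_const
    ((H.measurable_h s h1).mono (H.pastSigma_le s) le_rfl) (H.measurable_X s h1)

lemma conditionalLaplace_ae_eq (H : IsFilteringModel P X Y ε h Q) (T : ℕ) :
    conditionalLaplace P X Y h Q T =ᵐ[P] fun ω => (laplace P X Y h Q T ω).toReal := by
  have h1 : ∫⁻ ω, energyWeight X h Q T ω ∂P ≠ ⊤ := by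
    refine ne_top_of_le_ne_top (b := 1) (by simp) ?_
    calc _ ≤ ∫⁻ _, 1 ∂P := lintegral_mono (energyWeight_le_one H T)
      _ = 1 := by simp
  have := toReal_condLExp (pastSigma Y T) (measurable_energyWeight H T).aemeasurable h1
  simp only [toReal_energyWeight] at this
  exact this.symm

lemma mainFactor_nonneg {g : ℝ} {t : ℕ} (hQ : 0 ≤ Q t) (hg : 0 ≤ g) (ω : Ω) :
    0 ≤ mainFactor P X Y ε h Q g t ω := by
  unfold mainFactor
  positivity

lemma condMartingaleM_succ (T : ℕ) (ω : Ω) : condMartingaleM P X Y ε h Q (T + 1) ω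
    = condMartingaleM P X Y ε h Q T ω * martingaleFactor P X Y ε h Q (condSigmaSq P Y (T + 1) ω)
      (condSigmaBarSq P X Y ε h Q (T + 1) ω) (T + 1) ω := by
  rw [condMartingaleM, Finset.prod_Icc_succ_top (by omega)]
  rfl

lemma conditionalLaplace_eq_prod (H : IsFilteringModel P X Y ε h Q)
    (S : ∀ n, HasGaussianStep P X Y ε h Q n) (T : ℕ) :
    conditionalLaplace P X Y h Q T =ᵐ[P] fun ω =>
      (∏ t ∈ Finset.Icc 1 T, mainFactor P X Y ε h Q (condGammaTilde P X Y ε h Q t ω) t ω)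
        * condMartingaleM P X Y ε h Q T ω := by
  refine (conditionalLaplace_ae_eq H T).trans ?_
  induction T with
  | zero =>
    have : laplace P X Y h Q 0 =ᵐ[P] fun _ => 1 := by
      refine (ae_eq_condLExp (H.pastSigma_le 0) P _ measurable_const fun s _ => ?_).symm
      simp [energyWeight]
    filter_upwards [this] with ω hω
    simp [hω, condMartingaleM]
  | succ T ih =>
    obtain ⟨R, -, hR0, -, hR⟩ := (S T).exists_ratio
    filter_upwards [ih, (S T).laplace_succ, (S T).condGammaTilde_nonneg, hR] with ω e1 e2 e3 e4
    have h1 := mainFactor_nonneg (P := P) (X := X) (Y := Y) (ε := ε) (h := h)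
      (H.nonneg (T + 1) (by omega)) e3 ω
    rw [e2, condMartingaleM_succ, Finset.prod_Icc_succ_top (by omega), ENNReal.toReal_mul,
      ENNReal.toReal_mul, e1, ENNReal.toReal_ofReal h1, e4, ENNReal.toReal_ofReal (hR0 ω)]
    ring

lemma isMartingaleVersion_condMartingaleM (H : IsFilteringModel P X Y ε h Q)
    (S : ∀ n, HasGaussianStep P X Y ε h Q n) (hY : ∀ t, 1 ≤ t → Measurable (Y t)) :
    IsMartingaleVersion P (obsFiltration Y hY) (condMartingaleM P X Y ε h Q) := by
  choose R hRm hR0 hRg hR using fun n => (S n).exists_ratio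
  -- `R n` is the version of the factor of index `n + 1`, so the product over `range T` collects the
  -- factors `1, …, T`, each genuinely adapted.
  set N : ℕ → Ω → ℝ := fun T ω => ∏ n ∈ Finset.range T, R n ω with hN
  have hN0 : ∀ T ω, 0 ≤ N T ω := fun T ω => Finset.prod_nonneg fun n _ => hR0 n ω
  have hNm : ∀ T, Measurable[pastSigma Y T] (N T) := fun T => by
    have h1 : ∀ n ∈ Finset.range T, Measurable[pastSigma Y T] (R n) := fun n hn =>
      (hRm n).mono (pastSigma_mono _ (by simpa using hn)) le_rfl
    let _ := pastSigma Y T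
    exact Finset.measurable_prod _ h1
  have hNsucc : ∀ T ω, N (T + 1) ω = N T ω * R T ω := fun T ω => Finset.prod_range_succ _ _
  have hset : ∀ T s, MeasurableSet[pastSigma Y T] s →
      ∫⁻ ω in s, ENNReal.ofReal (N (T + 1) ω) ∂P = ∫⁻ ω in s, ENNReal.ofReal (N T ω) ∂P := by
    intro T s hs
    have hg : Measurable[pastSigma Y T] (s.indicator fun ω => ENNReal.ofReal (N T ω)) := by
      have := hNm T
      let _ := pastSigma Y T
      exact this.ennreal_ofReal.indicator hs
    rw [← lintegral_indicator (H.pastSigma_le T s hs),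
      ← lintegral_indicator (H.pastSigma_le T s hs),
      -- Test function: `N T` restricted to `s`. Nonnegativity allows this before integrability of
      -- the product is known.
      ← hRg T _ hg]
    refine lintegral_congr fun ω => ?_
    by_cases hω : ω ∈ s <;> simp [hω, hNsucc, ENNReal.ofReal_mul (hN0 T ω)]
  have hone : ∀ T, ∫⁻ ω, ENNReal.ofReal (N T ω) ∂P = 1 := by
    intro T
    induction T with
    | zero => simp [hN]
    | succ T ih =>
      rw [← ih, ← setLIntegral_univ, hset T _ MeasurableSet.univ, setLIntegral_univ]
  have hNmeas : ∀ T, AEStronglyMeasurable (N T) P := fun T =>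
    ((hNm T).mono (H.pastSigma_le T) le_rfl).aestronglyMeasurable
  have hNi : ∀ T, Integrable (N T) P := fun T => by
    refine (lintegral_ofReal_ne_top_iff_integrable (hNmeas T) (.of_forall (hN0 T))).1 ?_
    simp [hone]
  refine ⟨N, martingale_of_setIntegral_eq_succ (fun T => (hNm T).stronglyMeasurable) hNi
    fun T s hs => ?_, fun T => ?_⟩
  · rw [integral_eq_lintegral_of_nonneg_ae (.of_forall (hN0 _)) (hNmeas _).restrict,
      integral_eq_lintegral_of_nonneg_ae (.of_forall (hN0 _)) (hNmeas _).restrict, hset T s hs]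
  · induction T with
    | zero => simp [condMartingaleM, hN, Filter.EventuallyEq]
    | succ T ih =>
      filter_upwards [ih, hR T] with ω e1 e2
      rw [condMartingaleM_succ, e1, e2, hNsucc]

end

/-! ### Gaussian and conditionally Gaussian pairs as instances of the filtering step -/

section

variable {Ω : Type*} {mΩ : MeasurableSpace Ω} {P : Measure Ω} [IsProbabilityMeasure P]
  {X Y ε h : ℕ → Ω → ℝ} {Q : ℕ → ℝ}

lemma exists_isGaussianPrediction_of_conditionallyGaussianPair (H : IsFilteringModel P X Y ε h Q)
    (hXY : ConditionallyGaussianPair P X Y) (n : ℕ) :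
    ∃ (κ : Ω → Measure ((Finset.Icc 1 (n + 1) → ℝ) × ℝ))
      (ℓ : ℕ → StrongDual ℝ ((Finset.Icc 1 (n + 1) → ℝ) × ℝ))
      (η : StrongDual ℝ ((Finset.Icc 1 (n + 1) → ℝ) × ℝ)),
      IsGaussianPrediction P X Y
        (fun ω => ((fun s : Finset.Icc 1 (n + 1) => X s ω), Y (n + 1) ω)) κ ℓ η n := by
  have hV : Measurable[processSigma X Y]
      fun ω => ((fun s : Finset.Icc 1 (n + 1) => X s ω), Y (n + 1) ω) := by
    let _ := processSigma X Y
    exact (measurable_pi_lambda _ fun s : Finset.Icc 1 (n + 1) =>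
      measurable_processSigma_left (Finset.mem_Icc.1 s.2).1).prodMk
        (measurable_processSigma_right (by omega))
  refine ⟨_, fun s => if hs : s ∈ Finset.Icc 1 (n + 1) then
    (ContinuousLinearMap.proj (R := ℝ) (φ := fun _ => ℝ) ⟨s, hs⟩).comp
      (ContinuousLinearMap.fst ℝ _ _) else 0, ContinuousLinearMap.snd ℝ _ _, ?_,
    hXY (n + 1) (by omega), hV, fun s h1 h2 ω => ?_, fun ω => rfl⟩
  · rw [pastSigma_eq_comap]
    exact IsCondLaw.of_condDistrib
      (measurable_pi_lambda _ fun s => H.measurable_Y s (Finset.mem_Icc.1 s.2).1)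
      (hV.mono (processSigma_le H.measurable_X H.measurable_Y) le_rfl)
  · simp [h1, h2]

/-- The vector `((X_1, Y_1), …, (X_n, Y_n))`. -/
def pairVector (X Y : ℕ → Ω → ℝ) (n : ℕ) (ω : Ω) (s : Finset.range n) : ℝ × ℝ :=
  (X (s + 1) ω, Y (s + 1) ω)

lemma measurable_pairVector (n : ℕ) : Measurable[processSigma X Y] (pairVector X Y n) := by
  let _ := processSigma X Y
  exact measurable_pi_lambda _ fun s => measurable_processSigma_pair (by omega)

/-- Start from the unconditional Gaussian law and condition on Y_1, …, Y_k one at a time. The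
conditional covariance does not involve the observed value, so it stays the same for all ω. -/
lemma exists_isCondLaw_pairVector (H : IsFilteringModel P X Y ε h Q) (hXY : GaussianPair P X Y)
    {n k : ℕ} (hk : k ≤ n) : ∃ κ : Ω → Measure (Finset.range n → ℝ × ℝ),
      IsCondLaw (pastSigma Y k) P (pairVector X Y n) κ ∧ (∀ ω, IsGaussian (κ ω))
      ∧ ∀ ω ω' M N, covarianceBilinDual (κ ω) M N = covarianceBilinDual (κ ω') M N := by
  induction k with
  | zero =>
    have hG : IsGaussian (P.map (pairVector X Y n)) :=
      (hXY.hasGaussianLaw (Finset.range n)).isGaussian_map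
    refine ⟨_, ?_, fun _ => hG, fun _ _ _ _ => rfl⟩
    rw [pastSigma_zero]
    exact IsCondLaw.of_bot ((measurable_pairVector n).mono
      (processSigma_le H.measurable_X H.measurable_Y) le_rfl)
  | succ k ih =>
    obtain ⟨κ, h1, h2, h3⟩ := ih (by omega)
    -- Coordinates are shifted by one: Y_{k+1} sits in position `k`.
    let L : StrongDual ℝ (Finset.range n → ℝ × ℝ) := (ContinuousLinearMap.snd ℝ ℝ ℝ).comp
      (ContinuousLinearMap.proj (R := ℝ) (φ := fun _ => ℝ × ℝ) ⟨k, by simpa using hk⟩)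
    refine ⟨fun ω => condOn (κ ω) L (Y (k + 1) ω), ?_, fun ω => inferInstance,
      fun ω ω' M N => ?_⟩
    · rw [pastSigma_succ]
      exact h1.condOn (.of_forall h2) L
    · simp only [covarianceBilinDual_condOn, h3 ω ω']

lemma exists_isGaussianPrediction_of_gaussianPair (H : IsFilteringModel P X Y ε h Q)
    (hXY : GaussianPair P X Y) (n : ℕ) :
    ∃ (κ : Ω → Measure (Finset.range (n + 1) → ℝ × ℝ))
      (ℓ : ℕ → StrongDual ℝ (Finset.range (n + 1) → ℝ × ℝ))
      (η : StrongDual ℝ (Finset.range (n + 1) → ℝ × ℝ)),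
      IsGaussianPrediction P X Y (pairVector X Y (n + 1)) κ ℓ η n ∧ (∀ ω, IsGaussian (κ ω))
      ∧ ∀ ω ω' M N, covarianceBilinDual (κ ω) M N = covarianceBilinDual (κ ω') M N := by
  obtain ⟨κ, h1, h2, h3⟩ := exists_isCondLaw_pairVector H hXY (n := n + 1) (k := n) (by omega)
  refine ⟨κ, fun s => if hs : s - 1 ∈ Finset.range (n + 1) then
    (ContinuousLinearMap.fst ℝ ℝ ℝ).comp
      (ContinuousLinearMap.proj (R := ℝ) (φ := fun _ => ℝ × ℝ) ⟨s - 1, hs⟩) else 0,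
    (ContinuousLinearMap.snd ℝ ℝ ℝ).comp
      (ContinuousLinearMap.proj (R := ℝ) (φ := fun _ => ℝ × ℝ) ⟨n, by simp⟩),
    ⟨h1, .of_forall h2, measurable_pairVector _, fun s hs1 hs2 ω => ?_, fun ω => rfl⟩, h2, h3⟩
  have hs : s - 1 ∈ Finset.range (n + 1) := by simp; omega
  rw [dif_pos hs]
  simp [pairVector, Nat.sub_add_cancel hs1]

lemma exists_ae_eq_const {f g : Ω → ℝ} (h : f =ᵐ[P] g) (hg : ∀ ω ω', g ω = g ω') :
    ∃ c, f =ᵐ[P] fun _ => c := by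
  obtain ⟨ω₀⟩ : Nonempty Ω := P.nonempty_of_neZero
  exact ⟨g ω₀, h.trans (.of_forall fun ω => hg ω ω₀)⟩

/-- For a Gaussian pair the conditional variances are deterministic. -/
lemma exists_condVariances_ae_eq_const (H : IsFilteringModel P X Y ε h Q)
    (hXY : GaussianPair P X Y) (n : ℕ) :
    (∃ c, condSigmaSq P Y (n + 1) =ᵐ[P] fun _ => c)
    ∧ (∃ c, condSigmaBarSq P X Y ε h Q (n + 1) =ᵐ[P] fun _ => c)
    ∧ ∃ c, condGammaTilde P X Y ε h Q (n + 1) =ᵐ[P] fun _ => c := by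
  obtain ⟨κ, ℓ, η, G, hG, hC⟩ := exists_isGaussianPrediction_of_gaussianPair H hXY n
  refine ⟨exists_ae_eq_const (G.condSigmaSq_eq H).2 fun ω ω' => hC ω ω' _ _,
    exists_ae_eq_const (G.condSigmaBarSq_eq H).2 fun ω ω' => ?_,
    exists_ae_eq_const (G.condGammaTilde_eq H).2 fun ω ω' => ?_⟩
  · exact covarianceBilinDual_weighted_prodWeight_congr H.nonneg _ _ ℓ (hC ω ω') _ _ n _ _
  · refine covarianceBilinDual_weighted_prodWeight_congr H.nonneg _ _ ℓ (fun M N => ?_) _ _ n _ _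
    simp only [covarianceBilinDual_condOn, hC ω ω']

/-- A constant conditional second moment integrates to itself, which gives square integrability and
the value of the unconditional moment at once. -/
lemma memLp_two_of_condMean_sq_ae_eq_const {Ω : Type*} {m mΩ : MeasurableSpace Ω} {P : Measure Ω}
    [IsProbabilityMeasure P] (hm : m ≤ mΩ) {f : Ω → ℝ}
    (hf : Measurable f) (hi : CondIntegrable m P fun ω => f ω ^ 2) {c : ℝ}
    (hc : condMean m P (fun ω => f ω ^ 2) =ᵐ[P] fun _ => c) :
    MemLp f 2 P ∧ ∫ ω, f ω ^ 2 ∂P = c := by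
  have h0 : condLExp m P (fun ω => ENNReal.ofReal (-f ω ^ 2)) =ᵐ[P] fun _ => 0 := by
    refine (ae_eq_condLExp hm P _ measurable_const fun s _ => ?_).symm
    simp [ENNReal.ofReal_of_nonpos (neg_nonpos.2 (sq_nonneg _))]
  have h1 : ∀ᵐ ω ∂P, condLExp m P (fun ω => ENNReal.ofReal (f ω ^ 2)) ω = ENNReal.ofReal c
      ∧ 0 ≤ c := by
    -- `CondIntegrable` excludes the value `⊤`, which `toReal` would silently turn into zero.
    filter_upwards [h0, hi, hc] with ω e1 e2 e3
    simp only [abs_pow, sq_abs] at e2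
    rw [condMean, e1, ENNReal.toReal_zero, sub_zero] at e3
    rw [← e3]
    exact ⟨(ENNReal.ofReal_toReal e2.ne).symm, ENNReal.toReal_nonneg⟩
  have h2 : ∫⁻ ω, ENNReal.ofReal (f ω ^ 2) ∂P = ENNReal.ofReal c := by
    rw [← lintegral_condLExp hm, lintegral_congr_ae (h1.mono fun _ h => h.1)]
    simp
  have hf2 : AEStronglyMeasurable (fun ω => f ω ^ 2) P := (hf.pow_const 2).aestronglyMeasurable
  refine ⟨(memLp_two_iff_integrable_sq hf.aestronglyMeasurable).2
    ((lintegral_ofReal_ne_top_iff_integrable hf2 (.of_forall fun ω => sq_nonneg _)).1 ?_), ?_⟩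
  · simp [h2]
  · obtain ⟨ω, hω⟩ := h1.exists
    rw [integral_eq_lintegral_of_nonneg_ae (.of_forall fun ω => sq_nonneg _) hf2, h2,
      ENNReal.toReal_ofReal hω.2]

end

end LEGFilter

open LEGFilter in
theorem proposition2 {Ω : Type*} {mΩ : MeasurableSpace Ω} (P : Measure Ω) [IsProbabilityMeasure P]
    (X Y ε h : ℕ → Ω → ℝ) (Q : ℕ → ℝ)
    (hX : ∀ t, 1 ≤ t → Measurable (X t)) (hY : ∀ t, 1 ≤ t → Measurable (Y t))
    (hε : IsAuxiliaryNoise P X Y ε)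
    (hQ : ∀ t, 1 ≤ t → 0 ≤ Q t)
    (hh : ∀ t, 1 ≤ t → Measurable[pastSigma Y t] (h t)) :
    -- Gaussian pairs, with deterministic variances
    (GaussianPair P X Y → (∀ t, 1 ≤ t → 0 < sigmaSq P Y t) →
      (∀ t, 1 ≤ t → MomentsExist P X Y ε h Q t) ∧
      (∀ t, 1 ≤ t → MemLp (errY P Y t) 2 P ∧ MemLp (errYBar P X Y ε h Q t) 2 P ∧
        MemLp (errX P X Y ε h Q t) 2 P) ∧
      (∀ t, 1 ≤ t → 0 < sigmaBarSq P X Y ε h Q t) ∧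
      (∀ T, 1 ≤ T → conditionalLaplace P X Y h Q T =ᵐ[P] fun ω =>
        (∏ t ∈ Finset.Icc 1 T, mainFactor P X Y ε h Q (gammaTilde P X Y ε h Q t) t ω)
          * martingaleM P X Y ε h Q T ω) ∧
      IsMartingaleVersion P (obsFiltration Y hY) (martingaleM P X Y ε h Q)) ∧
    -- conditionally Gaussian pairs, with conditional variances
    (ConditionallyGaussianPair P X Y → (∀ t, 1 ≤ t → ∀ᵐ ω ∂P, 0 < condSigmaSq P Y t ω) →
      (∀ t, 1 ≤ t → MomentsExist P X Y ε h Q t) ∧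
      (∀ t, 1 ≤ t → ∀ᵐ ω ∂P, 0 < condSigmaBarSq P X Y ε h Q t ω) ∧
      (∀ T, 1 ≤ T → conditionalLaplace P X Y h Q T =ᵐ[P] fun ω =>
        (∏ t ∈ Finset.Icc 1 T, mainFactor P X Y ε h Q (condGammaTilde P X Y ε h Q t ω) t ω)
          * condMartingaleM P X Y ε h Q T ω) ∧
      IsMartingaleVersion P (obsFiltration Y hY) (condMartingaleM P X Y ε h Q)) := by
  have H : IsFilteringModel P X Y ε h Q := ⟨hX, hY, hε, hQ, hh⟩
  refine ⟨fun hXY hpos => ?_, fun hXY hpos => ?_⟩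
  -- The conditional variances are constants, and integration identifies these constants with σ_t²,
  -- σ̄_t² and γ̃_t. Positivity of σ_t² plays no role here.
  · have key : ∀ t, 1 ≤ t →
        ((MemLp (errY P Y t) 2 P ∧ condSigmaSq P Y t =ᵐ[P] fun _ => sigmaSq P Y t)
        ∧ (MemLp (errYBar P X Y ε h Q t) 2 P
          ∧ condSigmaBarSq P X Y ε h Q t =ᵐ[P] fun _ => sigmaBarSq P X Y ε h Q t)
        ∧ (MemLp (errX P X Y ε h Q t) 2 P
          ∧ condGammaTilde P X Y ε h Q t =ᵐ[P] fun _ => gammaTilde P X Y ε h Q t)) := by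
      intro t ht
      obtain ⟨n, rfl⟩ := Nat.exists_eq_add_of_le' ht
      obtain ⟨κ, ℓ, η, G, -, -⟩ := exists_isGaussianPrediction_of_gaussianPair H hXY n
      obtain ⟨⟨a, ha⟩, ⟨b, hb⟩, ⟨c, hc⟩⟩ := exists_condVariances_ae_eq_const H hXY n
      have hM := G.momentsExist H
      have h1 := memLp_two_of_condMean_sq_ae_eq_const (f := errY P Y (n + 1))
        (H.pastSigma_le n)
        ((hY _ ht).sub ((measurable_condMean _).mono (H.pastSigma_le n) le_rfl)) hM.varY ha
      have h2 := memLp_two_of_condMean_sq_ae_eq_const (f := errYBar P X Y ε h Q (n + 1))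
        (H.auxSigma_le n n)
        ((hY _ ht).sub ((measurable_condMean _).mono (H.auxSigma_le n n) le_rfl)) hM.varYBar hb
      have h3 := memLp_two_of_condMean_sq_ae_eq_const (f := errX P X Y ε h Q (n + 1))
        (H.auxSigma_le (n + 1) n)
        ((hX _ ht).sub ((measurable_condMean _).mono (H.auxSigma_le (n + 1) n) le_rfl)) hM.varX hc
      refine ⟨⟨h1.1, ?_⟩, ⟨h2.1, ?_⟩, h3.1, ?_⟩
      · rwa [sigmaSq, h1.2]
      · rwa [sigmaBarSq, h2.2]
      · rwa [gammaTilde, h3.2]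
    have S : ∀ n, HasGaussianStep P X Y ε h Q n := fun n => by
      obtain ⟨κ, ℓ, η, G, -, -⟩ := exists_isGaussianPrediction_of_gaussianPair H hXY n
      refine G.hasGaussianStep H ?_
      filter_upwards [(key (n + 1) (by omega)).1.2] with ω hω
      rw [hω]
      exact hpos _ (by omega)
    -- One null set for all times, so that the conditional variances can be replaced inside the
    -- products.
    have hall : ∀ᵐ ω ∂P, ∀ t, 1 ≤ t → condSigmaSq P Y t ω = sigmaSq P Y t
        ∧ condSigmaBarSq P X Y ε h Q t ω = sigmaBarSq P X Y ε h Q t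
        ∧ condGammaTilde P X Y ε h Q t ω = gammaTilde P X Y ε h Q t := by
      rw [ae_all_iff]
      intro t
      by_cases ht : 1 ≤ t
      · filter_upwards [(key t ht).1.2, (key t ht).2.1.2, (key t ht).2.2.2] with ω a b c _
        exact ⟨a, b, c⟩
      · exact .of_forall fun ω h1 => absurd h1 ht
    have hmart : ∀ T, martingaleM P X Y ε h Q T =ᵐ[P] condMartingaleM P X Y ε h Q T := fun T => by
      filter_upwards [hall] with ω hω
      refine Finset.prod_congr rfl fun t ht => ?_
      obtain ⟨a, b, -⟩ := hω t (Finset.mem_Icc.1 ht).1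
      rw [a, b]
    refine ⟨fun t ht => ?_, fun t ht => ⟨(key t ht).1.1, (key t ht).2.1.1, (key t ht).2.2.1⟩,
      fun t ht => ?_, fun T _ => ?_, ?_⟩
    · obtain ⟨n, rfl⟩ := Nat.exists_eq_add_of_le' ht
      exact (S n).momentsExist
    · obtain ⟨n, rfl⟩ := Nat.exists_eq_add_of_le' ht
      -- A constant that is almost surely positive is positive: one sample point suffices.
      obtain ⟨ω, h1, h2⟩ := ((S n).condSigmaBarSq_pos.and (key _ ht).2.1.2).exists
      rwa [h2] at h1
    · filter_upwards [conditionalLaplace_eq_prod H S T, hall, hmart T] with ω e1 hω e2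
      rw [e1, e2]
      congr 1
      refine Finset.prod_congr rfl fun t ht => ?_
      rw [(hω t (Finset.mem_Icc.1 ht).1).2.2]
    · obtain ⟨N, hN, hN'⟩ := isMartingaleVersion_condMartingaleM H S hY
      exact ⟨N, hN, fun T => (hmart T).trans (hN' T)⟩
  · have S : ∀ n, HasGaussianStep P X Y ε h Q n := fun n => by
      obtain ⟨κ, ℓ, η, G⟩ := exists_isGaussianPrediction_of_conditionallyGaussianPair H hXY n
      exact G.hasGaussianStep H (hpos _ (by omega))
    refine ⟨fun t ht => ?_, fun t ht => ?_, fun T _ => conditionalLaplace_eq_prod H S T,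
      isMartingaleVersion_condMartingaleM H S hY⟩
    · obtain ⟨n, rfl⟩ := Nat.exists_eq_add_of_le' ht
      exact (S n).momentsExist
    · obtain ⟨n, rfl⟩ := Nat.exists_eq_add_of_le' ht
      exact (S n).condSigmaBarSq_pos
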